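/- **Model.** Let $\Sigma$ be a finite nonempty input alphabet, and let $\lambda$ denote the empty string. A *one-way probabilistic pushdown automaton* (1ppda) $M$ consists of a finite set $Q$ of states, a finite stack alphabet $\Gamma$, a finite set $\Theta\subseteq\Gamma^*$ with $\lambda\in\Theta$, an initial state $q_0\in Q$, a bottom marker $Z_0\in\Gamma$, disjoint sets $Q_{acc},Q_{rej}\subseteq Q$, and transition probabilities $\delta(q,\sigma,a\,|\,p,u)\in[0,1]$ for $q,p\in Q$, $a\in\Gamma$, $u\in\Theta$ and $\sigma$ a tape symbol or $\sigma=\lambda$: in state $q$ with topmost stack symbol $a$, the machine reads $\sigma$ (reads nothing if $\sigma=\lambda$), enters $p$ and replaces $a$ by $u$. Nonzero transitions satisfy $u\in(\Gamma\setminus\{Z_0\})^*$ if $a\ne Z_0$ and $u\in(\Gamma\setminus\{Z_0\})^*Z_0$ if $a=Z_0$. Put $\delta[q,\sigma,a]=\sum_{p,u}\delta(q,\sigma,a\,|\,p,u)$. Computations start in state $q_0$ with stack $Z_0$ and the head on the leftmost tape symbol, and on every input all computation paths halt after finitely many steps. The probability of a path is the product of the probabilities of its moves; $p_{M,acc}(x)$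 and $p_{M,rej}(x)$ are the sums of the probabilities of the accepting and of the rejecting paths on input $x\in\Sigma^*$. * *Endmarker 1ppda:* the tape contains ¢$x$\$ and the tape symbols are those of $\Sigma\cup\{$¢$,\$\}$; states in $Q_{acc}\cup Q_{rej}$ are halting and have no moves; $\delta[q,\sigma,a]+\delta[q,\lambda,a]=1$ for all non-halting $q$, all tape symbols $\sigma$ and all $a$; the first step is not a $\lambda$-move, i.e. $\delta[q_0,\lambda,Z_0]=0$. A path is accepting (rejecting) if it ends in $Q_{acc}$ ($Q_{rej}$). After \$ has been read only $\lambda$-moves are possible, and they are made with total probability $1$ until a halting state is entered. * *No-endmarker 1ppda:* the tape contains $x$ and the tape symbols are those of $\Sigma$; $Q=Q_{acc}\cup Q_{rej}$; $\delta[q,\sigma,a]+\delta[q,\lambda,a]=1$ for all $\sigma\in\Sigma$ and $(q,a)\neq(q_0,Z_0)$; $\delta[q_0,\sigma,Z_0]=1$ for all $\sigma\in\Sigma$, i.e. on nonempty inputs the first step reads a symbol; the $\lambda$-moves $\delta(q_0,\lambda,Z_0\,|\,p,u)$, with $\delta[q_0,\lambda,Z_0]\le1$, are available only on the empty input. Once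 the whole input has been read, in state $q$ with topmost stack symbol $a$, the machine makes the available $\lambda$-moves with their probabilities and stops with the remaining probability; the path is accepting or rejecting according to whether $q\in Q_{acc}$ or $q\in Q_{rej}$ when it stops. The *push size* is the least positive integer $e$ such that all strings in $\Theta$ have length at most $e$. Two 1ppda's $M,N$ are *error-equivalent* if they recognize the same language $\{x : p_{acc}(x)>1/2\}$ and $p_{M,acc}(x)=p_{N,acc}(x)$, $p_{M,rej}(x)=p_{N,rej}(x)$ for every input $x$. A 1ppda is *in ideal shape* if, for all states $p,q$, tape symbols $\sigma$, $a\in\Gamma$ and $u\in\Gamma^*$: 1. if $\delta(q,\sigma,a\,|\,p,u)\ne0$, then $u\in\{\lambda,a\}$ or $u=ba$ for some $b\in\Gamma\setminus\{Z_0\}$; 2. if $\delta(q,\lambda,a\,|\,p,u)\neq0$, then $a\ne Z_0$ and $u=\lambda$; 3. if $\delta(q,\sigma,a\,|\,p,ba)\ne0$ with $b\in\Gamma\setminus\{Z_0\}$, then $\delta[p,\lambda,b]=0$; 4. if $\delta(q,\sigma,a\,|\,p,a)\neq0$, then $\delta[p,\lambda,a]=0$. For no-endmarker 1ppda's these conditions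 are required only for nonempty inputs, that is, the transitions $\delta(q_0,\lambda,Z_0\,|\,\cdot,\cdot)$, which are available only on the empty input, are disregarded. **Lemma (Ideal Shape Lemma).** There is an absolute constant $C$ such that the following holds for all positive integers $n,m,e$. For every endmarker 1ppda $M$ with $n$ states, stack alphabet size $m$ and push size $e$ there is an error-equivalent endmarker 1ppda $N$ over the same input alphabet that is in ideal shape and has at most $C\,e\,n^2m^2(2m)^{2enm}$ states and stack alphabet size at most $C\,e\,n\,m\,(2m)^{2enm}$. The same holds with "no-endmarker" in place of "endmarker" for both $M$ and $N$. -/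

import Mathlib

open scoped NNReal ENNReal

namespace OnePPDA

/-- The tape alphabet of the model with endmarkers: `A` together with `¢` (left) and `$` (right). -/
inductive Tape (A : Type*) where
  | left : Tape A
  | sym : A → Tape A
  | right : Tape A

/-- The tape content `¢ x $`. -/
def endmarked {A : Type*} (x : List A) : List (Tape A) :=
  Tape.left :: (x.map Tape.sym ++ [Tape.right])

/-- The data common to both models. `S` is the set of symbols on the input tape, `Q` the set of
inner states, `G` the stack alphabet. `delta q s a p u` is the probability `δ(q,s,a | p,u)`, where
`s = none` stands for a `λ`-move. Stack contents are lists whose head is the topmost symbol. -/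
structure Core (S Q G : Type*) where
  /-- the finite set of strings that may be written on the stack in one step -/
  theta : Finset (List G)
  nil_mem_theta : [] ∈ theta
  delta : Q → Option S → G → Q → List G → ℝ≥0
  mem_theta : ∀ q s a p u, delta q s a p u ≠ 0 → u ∈ theta
  q0 : Q
  Z0 : G
  acc : Set Q
  rej : Set Q
  disjoint_acc_rej : Disjoint acc rej
  /-- the bottom marker is never written above another symbol and is never removed -/
  delta_of_ne_bottom : ∀ q s a p u, delta q s a p u ≠ 0 → a ≠ Z0 → Z0 ∉ u
  delta_of_bottom : ∀ q s p u, delta q s Z0 p u ≠ 0 → ∃ v, Z0 ∉ v ∧ u = v ++ [Z0]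

/-- The push size: the least positive `e` such that every string of `theta` has length at
most `e`. -/
noncomputable def Core.pushSize {S Q G : Type*} (M : Core S Q G) : ℕ :=
  sInf {e : ℕ | 0 < e ∧ ∀ u ∈ M.theta, u.length ≤ e}

section Semantics

variable {S Q G : Type*}

/-- A configuration: inner state, part of the input tape not yet read, stack content. -/
abbrev Config (S Q G : Type*) := Q × List S × List G

/-- `δ[q,s,a]`, the total probability of the moves on `s`. -/
def total [Fintype Q] (th : Finset (List G)) (d : Q → Option S → G → Q → List G → ℝ≥0)
    (q : Q) (s : Option S) (a : G) : ℝ≥0 :=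
  ∑ p : Q, ∑ u ∈ th, d q s a p u

/-- `Follows d c c'`: the configuration `c'` follows `c` with nonzero probability. -/
inductive Follows (d : Q → Option S → G → Q → List G → ℝ≥0) :
    Config S Q G → Config S Q G → Prop
  | lam (q : Q) (a : G) (p : Q) (u : List G) (rest : List S) (z : List G)
      (h : d q none a p u ≠ 0) : Follows d (q, rest, a :: z) (p, rest, u ++ z)
  | read (q : Q) (s : S) (a : G) (p : Q) (u : List G) (rest : List S) (z : List G)
      (h : d q (some s) a p u ≠ 0) : Follows d (q, s :: rest, a :: z) (p, rest, u ++ z)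

/-- There is no infinite computation path from `c`. -/
def NoInfinitePath (d : Q → Option S → G → Q → List G → ℝ≥0) (c : Config S Q G) : Prop :=
  ¬ ∃ f : ℕ → Config S Q G, f 0 = c ∧ ∀ k, Follows d (f k) (f (k + 1))

/-- The sum, over all computation paths with exactly `t` moves from the given configuration, of
the product of the probabilities of the moves, times `fin` of the last configuration. -/
def pathWeight [Fintype Q] (th : Finset (List G)) (d : Q → Option S → G → Q → List G → ℝ≥0)
    (fin : Config S Q G → ℝ≥0) : ℕ → Q → List S → List G → ℝ≥0
  | 0, q, rest, z => fin (q, rest, z)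
  | _ + 1, _, _, [] => 0
  | t + 1, q, [], a :: z =>
      ∑ p : Q, ∑ u ∈ th, d q none a p u * pathWeight th d fin t p [] (u ++ z)
  | t + 1, q, s :: rest, a :: z =>
      (∑ p : Q, ∑ u ∈ th, d q none a p u * pathWeight th d fin t p (s :: rest) (u ++ z)) +
        ∑ p : Q, ∑ u ∈ th, d q (some s) a p u * pathWeight th d fin t p rest (u ++ z)

/-- The ideal-shape conditions for a transition function `d` with bottom marker `Z`. -/
structure IdealConditions [Fintype Q] (th : Finset (List G)) (Z : G)
    (d : Q → Option S → G → Q → List G → ℝ≥0) : Prop where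
  /-- a move reading a tape symbol pops, is stationary, or pushes one symbol -/
  read_move : ∀ q s a p u, d q (some s) a p u ≠ 0 →
    u = [] ∨ u = [a] ∨ ∃ b, b ≠ Z ∧ u = [b, a]
  /-- a `λ`-move pops (as the bottom marker cannot be popped, there is no `λ`-move on it) -/
  lam_move : ∀ q a p u, d q none a p u ≠ 0 → a ≠ Z ∧ u = []
  /-- no `λ`-move right after a push -/
  after_push : ∀ q s a p b, b ≠ Z → d q (some s) a p [b, a] ≠ 0 → total th d p none b = 0
  /-- no `λ`-move right after a stationary move -/
  after_stationary : ∀ q s a p, d q (some s) a p [a] ≠ 0 → total th d p none a = 0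

end Semantics

/-! ### The model with endmarkers -/

/-- A one-way probabilistic pushdown automaton with two endmarkers and input alphabet `A`. -/
structure Endmarker (A Q G : Type*) [Fintype Q] extends Core (Tape A) Q G where
  /-- there are no moves from halting states -/
  delta_halt : ∀ q s a p u, q ∈ acc ∪ rej → delta q s a p u = 0
  /-- the probability requirement -/
  prob : ∀ q, q ∉ acc ∪ rej → ∀ (s : Tape A) (a : G),
    total theta delta q (some s) a + total theta delta q none a = 1
  /-- the first step is not a `λ`-move -/
  first_step : total theta delta q0 none Z0 = 0
  /-- all computation paths halt on every input: there is no infinite path ... -/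
  no_infinite_path : ∀ x : List A, NoInfinitePath delta (q0, endmarked x, [Z0])
  /-- ... and, once the whole tape has been read, no path gets stuck in a non-halting state -/
  not_stuck : ∀ (x : List A) (q : Q) (a : G) (z : List G),
    Relation.ReflTransGen (Follows delta) (q0, endmarked x, [Z0]) (q, [], a :: z) →
    q ∉ acc ∪ rej → total theta delta q none a = 1

namespace Endmarker

variable {A Q G : Type*} [Fintype Q]

open scoped Classical in
/-- The sum of the probabilities of all computation paths on `x` ending in a state of `F`, for
a set `F` of halting states. -/
noncomputable def haltProb (M : Endmarker A Q G) (F : Set Q) (x : List A) : ℝ≥0∞ :=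
  ∑' t : ℕ, (pathWeight M.theta M.delta (fun c => if c.1 ∈ F then 1 else 0) t
    M.q0 (endmarked x) [M.Z0] : ℝ≥0∞)

noncomputable def accProb (M : Endmarker A Q G) (x : List A) : ℝ≥0∞ := M.haltProb M.acc x

noncomputable def rejProb (M : Endmarker A Q G) (x : List A) : ℝ≥0∞ := M.haltProb M.rej x

/-- The recognized language. -/
def language (M : Endmarker A Q G) : Set (List A) := {x | 1 / 2 < M.accProb x}

/-- Same language, and the same probabilities of acceptance and of rejection on every input. -/
def ErrorEquivalent {Q' G' : Type*} [Fintype Q'] (M : Endmarker A Q G)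
    (N : Endmarker A Q' G') : Prop :=
  M.language = N.language ∧ ∀ x, M.accProb x = N.accProb x ∧ M.rejProb x = N.rejProb x

def IdealShape (M : Endmarker A Q G) : Prop := IdealConditions M.theta M.Z0 M.delta

end Endmarker

/-! ### The model without endmarkers -/

open scoped Classical in
/-- The transition function in force on input `x` in the model without endmarkers. In the initial
situation `(q0, Z0)` the machine has to read the leftmost symbol of a nonempty input; as there is
nothing to read on the empty input, the values `δ(q0,λ,Z0 | p,u)` are in force there, and
only there. -/
noncomputable def Core.deltaOn {A Q G : Type*} (M : Core A Q G) (x : List A) :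
    Q → Option A → G → Q → List G → ℝ≥0 :=
  fun q s a p u => if x ≠ [] ∧ q = M.q0 ∧ s = none ∧ a = M.Z0 then 0 else M.delta q s a p u

/-- A one-way probabilistic pushdown automaton without endmarkers and with input alphabet `A`. -/
structure NoEndmarker (A Q G : Type*) [Fintype Q] extends Core A Q G where
  /-- the states are partitioned into accepting and rejecting ones -/
  acc_union_rej : acc ∪ rej = Set.univ
  /-- the probability requirement -/
  prob : ∀ (q : Q) (s : A) (a : G), ¬ (q = q0 ∧ a = Z0) →
    total theta delta q (some s) a + total theta delta q none a = 1
  /-- the first step on a nonempty input reads a symbol -/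
  first_step : ∀ s : A, total theta delta q0 (some s) Z0 = 1
  /-- the first step on the empty input may be a `λ`-move -/
  first_step_empty : total theta delta q0 none Z0 ≤ 1
  /-- all computation paths halt on every input -/
  no_infinite_path : ∀ x : List A, NoInfinitePath (toCore.deltaOn x) (q0, x, [Z0])

namespace NoEndmarker

variable {A Q G : Type*} [Fintype Q]

open scoped Classical in
/-- The probability that the machine stops at a configuration, in a state of `F`, in the run on
input `x`: it stops when the whole input has been read and no (further) `λ`-move is selected. -/
noncomputable def stopProb (M : NoEndmarker A Q G) (F : Set Q) (x : List A) :
    Config A Q G → ℝ≥0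
  | (q, [], a :: _) => if q ∈ F then 1 - total M.theta (M.deltaOn x) q none a else 0
  | _ => 0

/-- The sum of the probabilities of all computation paths on `x` ending in a state of `F`. -/
noncomputable def haltProb (M : NoEndmarker A Q G) (F : Set Q) (x : List A) : ℝ≥0∞ :=
  ∑' t : ℕ, (pathWeight M.theta (M.deltaOn x) (M.stopProb F x) t M.q0 x [M.Z0] : ℝ≥0∞)

noncomputable def accProb (M : NoEndmarker A Q G) (x : List A) : ℝ≥0∞ := M.haltProb M.acc x

noncomputable def rejProb (M : NoEndmarker A Q G) (x : List A) : ℝ≥0∞ := M.haltProb M.rej x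

/-- The recognized language. -/
def language (M : NoEndmarker A Q G) : Set (List A) := {x | 1 / 2 < M.accProb x}

/-- Same language, and the same probabilities of acceptance and of rejection on every input. -/
def ErrorEquivalent {Q' G' : Type*} [Fintype Q'] (M : NoEndmarker A Q G)
    (N : NoEndmarker A Q' G') : Prop :=
  M.language = N.language ∧ ∀ x, M.accProb x = N.accProb x ∧ M.rejProb x = N.rejProb x

/-- The ideal-shape conditions are required on nonempty inputs only. -/
def IdealShape (M : NoEndmarker A Q G) : Prop :=
  ∀ x : List A, x ≠ [] → IdealConditions M.theta M.Z0 (M.deltaOn x)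

end NoEndmarker

end OnePPDA

/-! The new machine does not imitate `λ`-moves one at a time. It draws the outcome of a whole
`λ`-run at once and keeps the top of the simulated stack in its state, so that what lies on its own
stack is untouched until the part in the state has been removed.

Two facts make this possible. First, in a non-halting situation (apart from the initial one without
endmarkers, treated separately) `δ[q,σ,a] + δ[q,λ,a] = 1` for every `σ`. So the probability of a
`λ`-move does not depend on the tape: the machine may perform all `λ`-moves until one is declined,
and only then read, with the conditional probabilities `δ(q,σ,a|p,u) / (1 - δ[q,λ,a])`
(`readPMF_spec`, `Simulable.isLamValue`). Secondly, a `λ`-run from a single stack symbol cannot meet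
the same state and topmost symbol again after its start, since it could then be repeated forever.
Hence the string that replaces this symbol has length at most `L₁ = 1 + (e-1)(nm-1)`
(`length_le_of_lamReach_card`).

A state `inl (q, y, t)` records a situation in which the last `λ`-move has been declined: `y`, with
`|y| ≤ L₁`, has grown out of one symbol, and `t`, with `|t| ≤ L₂ = (e-1)nm`, lies below it. Each
stack symbol is a block of at most `L₂` old symbols, and the new bottom marker carries no old
symbol. After reading, the run goes through the written string, the rest of `y`, and `t`. It may
stop above `t`, and `t` is pushed as a block if symbols remain between; it may stop inside `t`, and
nothing is pushed; or it may remove everything and go on through the next block, which is popped. In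
the last case a run that also removes this block ends in a state `inr p`, whose only possible
`λ`-moves pop further blocks. After a push or a stationary move no `λ`-move is possible, which is
ideal shape.

Equality of probabilities is shown with value functions. The path weight of the old machine solves
the one-step equation `IsLamValue`, hence equals the expected payoff at the end of the `λ`-run
(`stringRun_value`). Induction on a decreasing potential transfers this to the new machine
(`weight_idealDelta`). Counting blocks gives the size bounds with `C = 2`. -/

namespace OnePPDA

/-! ### One-step equations for the total path weight -/

section Weight

variable {S Q G : Type*} [Fintype Q]

/-- The total weight, over all computation paths from a configuration, of the last configuration. -/
noncomputable def weight (th : Finset (List G)) (d : Q → Option S → G → Q → List G → ℝ≥0)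
    (fin : Config S Q G → ℝ≥0) (q : Q) (rest : List S) (z : List G) : ℝ≥0∞ :=
  ∑' t : ℕ, (pathWeight th d fin t q rest z : ℝ≥0∞)

variable (th : Finset (List G)) (d : Q → Option S → G → Q → List G → ℝ≥0)
  (fin : Config S Q G → ℝ≥0)

theorem tsum_sum_mul (f : Q → List G → ℝ≥0) (g : ℕ → Q → List G → ℝ≥0∞) :
    ∑' t, ∑ p, ∑ u ∈ th, (f p u : ℝ≥0∞) * g t p u
      = ∑ p, ∑ u ∈ th, (f p u : ℝ≥0∞) * ∑' t, g t p u := by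
  rw [Summable.tsum_finsetSum (fun _ _ => ENNReal.summable)]
  refine Finset.sum_congr rfl fun p _ => ?_
  rw [Summable.tsum_finsetSum (fun _ _ => ENNReal.summable)]
  exact Finset.sum_congr rfl fun u _ => ENNReal.tsum_mul_left

theorem weight_cons_nil (q : Q) (a : G) (z : List G) :
    weight th d fin q [] (a :: z) = fin (q, [], a :: z) +
      ∑ p, ∑ u ∈ th, (d q none a p u : ℝ≥0∞) * weight th d fin p [] (u ++ z) := by
  rw [weight, tsum_eq_zero_add' ENNReal.summable]
  simp only [pathWeight]
  push_cast
  rw [tsum_sum_mul]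
  rfl

theorem weight_cons_cons (q : Q) (s : S) (rest : List S) (a : G) (z : List G) :
    weight th d fin q (s :: rest) (a :: z) = fin (q, s :: rest, a :: z) +
      (∑ p, ∑ u ∈ th, (d q none a p u : ℝ≥0∞) * weight th d fin p (s :: rest) (u ++ z) +
      ∑ p, ∑ u ∈ th, (d q (some s) a p u : ℝ≥0∞) * weight th d fin p rest (u ++ z)) := by
  rw [weight, tsum_eq_zero_add' ENNReal.summable]
  simp only [pathWeight]
  push_cast
  rw [ENNReal.tsum_add, tsum_sum_mul, tsum_sum_mul]
  rfl

end Weight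

/-! ### `λ`-runs and the length of the strings they produce -/

section LamStep

variable {S Q G : Type*}

/-- One `λ`-move on a state and a stack content. -/
inductive LamStep (d : Q → Option S → G → Q → List G → ℝ≥0) : Q × List G → Q × List G → Prop
  | mk (q : Q) (a : G) (p : Q) (u z : List G) (h : d q none a p u ≠ 0) :
      LamStep d (q, a :: z) (p, u ++ z)

/-- Reachability by `λ`-moves. -/
abbrev LamReach (d : Q → Option S → G → Q → List G → ℝ≥0) : Q × List G → Q × List G → Prop :=
  Relation.ReflTransGen (LamStep d)

/-- All sequences of `λ`-moves from the given situation are finite. -/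
abbrev LamTerm (d : Q → Option S → G → Q → List G → ℝ≥0) (c : Q × List G) : Prop :=
  Acc (fun x y => LamStep d y x) c

variable {d : Q → Option S → G → Q → List G → ℝ≥0}

theorem LamStep.append {q p : Q} {z z' : List G} (h : LamStep d (q, z) (p, z')) (w : List G) :
    LamStep d (q, z ++ w) (p, z' ++ w) := by
  cases h with
  | mk _ a _ u z h => simpa using LamStep.mk q a p u (z ++ w) h

theorem LamReach.append {q p : Q} {z z' : List G} (h : LamReach d (q, z) (p, z')) (w : List G) :
    LamReach d (q, z ++ w) (p, z' ++ w) :=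
  Relation.ReflTransGen.lift (p := LamStep d) (fun c : Q × List G => (c.1, c.2 ++ w))
    (fun _ _ hab => LamStep.append hab w) _ _ h

theorem LamStep.follows {c c' : Q × List G} (h : LamStep d c c') (rest : List S) :
    Follows d (c.1, rest, c.2) (c'.1, rest, c'.2) := by
  cases h with
  | mk q a p u z h => exact Follows.lam q a p u rest z h

theorem LamReach.follows {c c' : Q × List G} (h : LamReach d c c') (rest : List S) :
    Relation.ReflTransGen (Follows d) (c.1, rest, c.2) (c'.1, rest, c'.2) :=
  Relation.ReflTransGen.lift (p := Follows d) (fun c : Q × List G => (c.1, rest, c.2))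
    (fun _ _ hab => LamStep.follows hab rest) _ _ h

/-- A run on the upper part of a stack is also a run on the whole stack, so it inherits finiteness.
-/
theorem LamTerm.of_append {q : Q} {z w : List G} (h : LamTerm d (q, z ++ w)) :
    LamTerm d (q, z) := by
  have := InvImage.accessible (r := fun x y => LamStep d y x)
    (fun c : Q × List G => (c.1, c.2 ++ w)) (a := (q, z)) h
  exact Subrelation.accessible (fun {a b} hab => LamStep.append hab w) this

theorem LamTerm.reach {c c' : Q × List G} (h : LamTerm d c) (hr : LamReach d c c') :
    LamTerm d c' := by
  induction hr with
  | refl => exact h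
  | tail _ hs ih => exact ih.inv hs

theorem lamTerm_of_noInfinitePath {c : Config S Q G} (h : NoInfinitePath d c)
    {c' : Config S Q G} (hr : Relation.ReflTransGen (Follows d) c c') :
    LamTerm d (c'.1, c'.2.2) := by
  have h0 : Acc (fun x y => Follows d y x) c := by
    by_contra hc
    obtain ⟨f, h0, hf⟩ := not_acc_iff_exists_descending_chain.1 hc
    exact h ⟨f, h0, hf⟩
  have h1 : Acc (fun x y => Follows d y x) c' := by
    induction hr with
    | refl => exact h0
    | tail _ hs ih => exact ih.inv hs
  have := InvImage.accessible (r := fun x y => Follows d y x)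
    (fun x : Q × List G => (x.1, c'.2.1, x.2)) (a := (c'.1, c'.2.2)) h1
  exact Subrelation.accessible (fun {a b} hab => LamStep.follows hab _) this

/-- A run that starts with the stack content `u` and does not empty it ends as a run from a single
symbol of `u`, the symbols below it being untouched. -/
theorem LamReach.decompose {p₀ p : Q} {u y : List G} (h : LamReach d (p₀, u) (p, y)) :
    y = [] ∨ ∃ (c : G) (u' y' : List G) (p' : Q), (c :: u') <:+ u ∧
      LamReach d (p₀, u) (p', c :: u') ∧ LamReach d (p', [c]) (p, y') ∧ y = y' ++ u' := by
  generalize hx : (p, y) = x at h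
  induction h generalizing p y with
  | refl =>
    cases hx
    cases u with
    | nil => exact Or.inl rfl
    | cons c u => exact Or.inr ⟨c, u, [c], _, List.suffix_rfl, .refl, .refl, rfl⟩
  | tail hr hs ih =>
    subst hx
    rcases hs with ⟨q, a, _, w, z, hd⟩
    rcases ih rfl with h | ⟨c, u', y', p', hsuf, h1, h2, h3⟩
    · simp at h
    · right
      -- If `y'` is used up, the next move acts on a symbol of `u`, and the decomposition starts
      -- anew at that symbol.
      cases y' with
      | nil =>
        simp only [List.nil_append] at h3
        subst h3
        refine ⟨a, z, w, q, (List.suffix_cons c _).trans hsuf, hr, ?_, rfl⟩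
        simpa using Relation.ReflTransGen.single (LamStep.mk (d := d) q a _ w [] hd)
      | cons b y'' =>
        simp only [List.cons_append, List.cons.injEq] at h3
        obtain ⟨rfl, rfl⟩ := h3
        exact ⟨c, u', w ++ y'', p', hsuf, h1, h2.tail (LamStep.mk q a _ w y'' hd), by simp⟩

/-- The pairs of a state and a topmost symbol that occur after at least one `λ`-move. -/
def lamBelow (d : Q → Option S → G → Q → List G → ℝ≥0) (q : Q) (a : G) : Set (Q × G) :=
  {x | ∃ v, Relation.TransGen (LamStep d) (q, [a]) (x.1, x.2 :: v)}

/-- If the pair came back with some `v` below it, the same moves could be repeated above `v`, giving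
an infinite run. -/
theorem not_mem_lamBelow {q : Q} {a : G} (h : LamTerm d (q, [a])) : (q, a) ∉ lamBelow d q a := by
  rintro ⟨v, hv⟩
  -- The stack `w` below must be arbitrary, as it grows by `v` in each repetition.
  have key : ∀ x, Acc (Relation.TransGen fun x y => LamStep d y x) x → ∀ w, x ≠ (q, a :: w) := by
    intro x hx
    induction hx with
    | intro x _ ih =>
      rintro w rfl
      refine ih (q, a :: (v ++ w)) ?_ _ rfl
      rw [← Relation.transGen_swap]
      exact Relation.TransGen.lift (p := LamStep d) (fun c : Q × List G => (c.1, c.2 ++ w))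
        (fun _ _ hab => LamStep.append hab w) _ _ hv
  exact key _ h.transGen [] rfl

/-- After the first move the stack is some `u` with `|u| ≤ e`. A later nonempty stack is a run from
a single symbol `c` of `u`, with at most `e - 1` symbols below it. The pair at which this run starts
lies in `lamBelow d q a` but not in its own set, so the set shrinks strictly and induction on its
size applies. -/
theorem length_le_of_lamReach [Finite Q] [Finite G] {e : ℕ}
    (he : ∀ q s a p u, d q s a p u ≠ 0 → u.length ≤ e) (k : ℕ) :
    ∀ {q : Q} {a : G}, LamTerm d (q, [a]) → (lamBelow d q a).ncard ≤ k →
      ∀ {p : Q} {y : List G}, LamReach d (q, [a]) (p, y) → y.length ≤ 1 + (e - 1) * k := by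
  induction k with
  | zero =>
    intro q a hT hk p y hr
    rcases Relation.ReflTransGen.cases_head hr with h | ⟨c, hs, hr'⟩
    · cases h; simp
    cases y with
    | nil => simp
    | cons b y =>
      have : (p, b) ∈ lamBelow d q a := ⟨y, Relation.TransGen.head' hs hr'⟩
      rw [Nat.le_zero, Set.ncard_eq_zero] at hk
      simp [hk] at this
  | succ k ih =>
    intro q a hT hk p y hr
    rcases Relation.ReflTransGen.cases_head hr with h | ⟨⟨p₀, u⟩, hs, hr'⟩
    · cases h; simp
    rcases LamReach.decompose hr' with rfl | ⟨c, u', y', p', hsuf, h1, h2, rfl⟩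
    · simp
    have hmem : (p', c) ∈ lamBelow d q a := ⟨u', Relation.TransGen.head' hs h1⟩
    have hT' : LamTerm d (p', [c]) :=
      LamTerm.of_append (w := u') (hT.reach ((Relation.ReflTransGen.single hs).trans h1))
    have hss : lamBelow d p' c ⊂ lamBelow d q a := by
      refine ⟨?_, fun h => not_mem_lamBelow hT' (h hmem)⟩
      rintro ⟨r, b⟩ ⟨v, hv⟩
      refine ⟨v ++ u', (Relation.TransGen.head' hs h1).trans ?_⟩
      exact Relation.TransGen.lift (p := LamStep d) (fun c : Q × List G => (c.1, c.2 ++ u'))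
        (fun _ _ hab => LamStep.append hab u') _ _ hv
    have hlt := Set.ncard_lt_ncard hss
    have := ih hT' (by omega) h2
    have hu : u.length ≤ e := by
      rcases hs with ⟨_, _, _, w, z, hd⟩
      simpa using he _ _ _ _ _ hd
    have hl := hsuf.length_le
    simp only [List.length_cons, List.length_append] at hl ⊢
    rw [Nat.mul_succ]
    omega

theorem length_le_of_lamReach_card [Fintype Q] [Fintype G] {e : ℕ}
    (he : ∀ q s a p u, d q s a p u ≠ 0 → u.length ≤ e) {q : Q} {a : G} (h : LamTerm d (q, [a]))
    {p : Q} {y : List G} (hr : LamReach d (q, [a]) (p, y)) :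
    y.length ≤ 1 + (e - 1) * (Fintype.card Q * Fintype.card G - 1) := by
  refine length_le_of_lamReach he _ h ?_ hr
  have hlt : (lamBelow d q a).ncard < (Set.univ : Set (Q × G)).ncard :=
    Set.ncard_lt_ncard ⟨Set.subset_univ _, fun hh => not_mem_lamBelow h (hh (Set.mem_univ _))⟩
  rw [Set.ncard_univ, Nat.card_eq_fintype_card, Fintype.card_prod] at hlt
  omega

end LamStep

/-! ### Outcome distributions of `λ`-runs and of reading moves -/

section Runs

variable {S Q G : Type*} [Fintype Q]

/-- The expectation of a function under a probability mass function. -/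
noncomputable def expect {α : Type*} (μ : PMF α) (f : α → ℝ≥0∞) : ℝ≥0∞ := ∑' x, μ x * f x

theorem expect_pure {α : Type*} (a : α) (f : α → ℝ≥0∞) : expect (PMF.pure a) f = f a := by
  classical
  rw [expect, tsum_eq_single a]
  · simp
  · intro b hb; simp [hb]

theorem expect_bind {α β : Type*} (μ : PMF α) (k : α → PMF β) (f : β → ℝ≥0∞) :
    expect (μ.bind k) f = expect μ fun a => expect (k a) f := by
  simp only [expect, PMF.bind_apply, ← ENNReal.tsum_mul_right, ← ENNReal.tsum_mul_left]
  rw [ENNReal.tsum_comm]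
  simp only [mul_assoc]

theorem expect_map {α β : Type*} (μ : PMF α) (g : α → β) (f : β → ℝ≥0∞) :
    expect (μ.map g) f = expect μ fun a => f (g a) := by
  rw [PMF.map, expect_bind]
  simp [expect_pure]

theorem expect_congr {α : Type*} (μ : PMF α) {f g : α → ℝ≥0∞} (h : ∀ x ∈ μ.support, f x = g x) :
    expect μ f = expect μ g := by
  refine tsum_congr fun x => ?_
  by_cases hx : μ x = 0
  · simp [hx]
  · rw [h x ((PMF.mem_support_iff _ _).2 hx)]

theorem expect_eq_sum {α β : Type*} [Fintype α] (μ : PMF (α × β)) (th : Finset β)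
    (h : ∀ x ∈ μ.support, x.2 ∈ th) (f : α × β → ℝ≥0∞) :
    ∑ p, ∑ u ∈ th, ((μ (p, u)).toNNReal : ℝ≥0∞) * f (p, u) = expect μ f := by
  simp only [ENNReal.coe_toNNReal (PMF.apply_ne_top _ _)]
  rw [← Finset.sum_product' (Finset.univ) th (fun p u => μ (p, u) * f (p, u)), expect]
  refine (tsum_eq_sum fun x hx => ?_).symm
  by_cases h0 : μ x = 0
  · simp [h0]
  · simp [h x ((PMF.mem_support_iff _ _).2 h0)] at hx

/-- `V` is the value function, for the payoff `W` on stopping, of the `λ`-moves: with topmost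
symbol `a` the `λ`-moves are made with their probabilities, and the run stops otherwise. -/
structure IsLamValue (th : Finset (List G)) (d : Q → Option S → G → Q → List G → ℝ≥0)
    (V W : Q → List G → ℝ≥0∞) : Prop where
  cons : ∀ p a z, V p (a :: z) = ((1 - total th d p none a : ℝ≥0) : ℝ≥0∞) * W p (a :: z) +
    ∑ p', ∑ u ∈ th, (d p none a p' u : ℝ≥0∞) * V p' (u ++ z)

/-- `μ` is the distribution of the situation in which the `λ`-run from `c` stops. -/
structure IsLamRun (th : Finset (List G)) (d : Q → Option S → G → Q → List G → ℝ≥0)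
    (c : Q × List G) (μ : PMF (Q × List G)) : Prop where
  reach : ∀ x ∈ μ.support, LamReach d c x
  halted : ∀ x ∈ μ.support, ∀ a z, x.2 = a :: z → total th d x.1 none a ≠ 1
  value : ∀ V W : Q → List G → ℝ≥0∞, (∀ p, V p [] = W p []) → IsLamValue th d V W →
    V c.1 c.2 = expect μ fun x => W x.1 x.2

/-- Well-founded induction along `λ`-moves: with probability `1 - δ[q,λ,a]` the run stops at once,
otherwise a move is made and the distribution of its target is used. -/
theorem exists_isLamRun {th : Finset (List G)} {d : Q → Option S → G → Q → List G → ℝ≥0}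
    (hL : ∀ q a, total th d q none a ≤ 1) {c : Q × List G} (h : LamTerm d c) :
    ∃ μ, IsLamRun th d c μ := by
  classical
  -- It suffices to construct a weight function: the value property with `V = W = 1` shows that its
  -- total mass is 1.
  suffices H : ∃ μ : Q × List G → ℝ≥0∞, (∀ x, μ x ≠ 0 → LamReach d c x) ∧
      (∀ x, μ x ≠ 0 → ∀ a z, x.2 = a :: z → total th d x.1 none a ≠ 1) ∧
      ∀ V W : Q → List G → ℝ≥0∞, (∀ p, V p [] = W p []) → IsLamValue th d V W →
        V c.1 c.2 = ∑' x, μ x * W x.1 x.2 by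
    obtain ⟨μ, h1, h2, h3⟩ := H
    have hs : ∑' x, μ x = 1 := by
      have := h3 (fun _ _ => 1) (fun _ _ => 1) (fun _ => rfl) ⟨fun p a z => by
        simp only [mul_one]
        have : ∑ p', ∑ u ∈ th, (d p none a p' u : ℝ≥0∞) = (total th d p none a : ℝ≥0) := by
          simp [total]
        rw [this, ← ENNReal.coe_add, tsub_add_cancel_of_le (hL p a), ENNReal.coe_one]⟩
      simpa using this.symm
    refine ⟨⟨μ, by rw [← hs]; exact ENNReal.summable.hasSum⟩, ?_, ?_, h3⟩
    · exact fun x hx => h1 x hx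
    · exact fun x hx => h2 x hx
  induction h with
  | intro c _ ih =>
    obtain ⟨q, z⟩ := c
    cases z with
    | nil =>
      refine ⟨fun x => if x = (q, []) then 1 else 0, ?_, ?_, ?_⟩
      · intro x hx
        have : x = (q, []) := by by_contra h; simp [h] at hx
        rw [this]
      · intro x hx a z hz
        have : x = (q, []) := by by_contra h; simp [h] at hx
        simp [this] at hz
      · intro V W h0 _
        rw [tsum_eq_single (q, [])]
        · simp [h0]
        · intro b hb; simp [hb]
    | cons a z =>
      have : ∀ p u, ∃ μ : Q × List G → ℝ≥0∞, d q none a p u ≠ 0 →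
        (∀ x, μ x ≠ 0 → LamReach d (p, u ++ z) x) ∧
        (∀ x, μ x ≠ 0 → ∀ a z, x.2 = a :: z → total th d x.1 none a ≠ 1) ∧
        ∀ V W : Q → List G → ℝ≥0∞, (∀ p, V p [] = W p []) → IsLamValue th d V W →
          V p (u ++ z) = ∑' x, μ x * W x.1 x.2 := by
        intro p u
        by_cases hd : d q none a p u = 0
        · exact ⟨0, fun h => absurd hd h⟩
        · obtain ⟨μ, hμ⟩ := ih (p, u ++ z) (LamStep.mk q a p u z hd)
          exact ⟨μ, fun _ => hμ⟩
      choose μ hμ using this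
      refine ⟨fun x => (1 - total th d q none a : ℝ≥0) * (if x = (q, a :: z) then 1 else 0) +
        ∑ p, ∑ u ∈ th, (d q none a p u : ℝ≥0∞) * μ p u x, ?_, ?_, ?_⟩
      · intro x hx
        by_cases h : x = (q, a :: z)
        · rw [h]
        · simp only [h, if_false, mul_zero, zero_add, ne_eq, Finset.sum_eq_zero_iff, mul_eq_zero,
            not_forall, not_or] at hx
          obtain ⟨p, -, u, -, h1, h2⟩ := hx
          have h1 : d q none a p u ≠ 0 := by simpa using h1
          exact .head (LamStep.mk q a p u z h1) ((hμ p u h1).1 x h2)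
      · intro x hx b w hz hb
        by_cases h : ∃ p u, d q none a p u ≠ 0 ∧ μ p u x ≠ 0
        · obtain ⟨p, u, h1, h2⟩ := h
          exact (hμ p u h1).2.1 x h2 b w hz hb
        · push Not at h
          have : ∑ p, ∑ u ∈ th, (d q none a p u : ℝ≥0∞) * μ p u x = 0 := by
            refine Finset.sum_eq_zero fun p _ => Finset.sum_eq_zero fun u _ => ?_
            by_cases h1 : d q none a p u = 0
            · simp [h1]
            · simp [h p u h1]
          simp only [this, add_zero] at hx
          have hxe : x = (q, a :: z) := by by_contra h; simp [h] at hx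
          subst hxe
          simp only [List.cons.injEq] at hz
          obtain ⟨rfl, rfl⟩ := hz
          simp [hb] at hx
      · intro V W h0 hV
        simp only [add_mul]
        rw [ENNReal.tsum_add, hV.cons, tsum_eq_single (q, a :: z)]
        · simp only [if_true, mul_one]
          congr 1
          simp only [Finset.sum_mul]
          rw [Summable.tsum_finsetSum (fun _ _ => ENNReal.summable)]
          refine Finset.sum_congr rfl fun p _ => ?_
          rw [Summable.tsum_finsetSum (fun _ _ => ENNReal.summable)]
          refine Finset.sum_congr rfl fun u _ => ?_
          simp only [mul_assoc]
          rw [ENNReal.tsum_mul_left]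
          by_cases h1 : d q none a p u = 0
          · simp [h1]
          · rw [(hμ p u h1).2.2 V W h0 hV]
        · intro b hb; simp [hb]

open scoped Classical in
/-- The distribution of the situation in which the `λ`-run from `c` stops, if there is one. -/
noncomputable def lamPMF (th : Finset (List G)) (d : Q → Option S → G → Q → List G → ℝ≥0)
    (c : Q × List G) : PMF (Q × List G) :=
  if h : ∃ μ, IsLamRun th d c μ then h.choose else PMF.pure c

theorem isLamRun_lamPMF {th : Finset (List G)} {d : Q → Option S → G → Q → List G → ℝ≥0}
    (hL : ∀ q a, total th d q none a ≤ 1) {c : Q × List G} (h : LamTerm d c) :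
    IsLamRun th d c (lamPMF th d c) := by
  have h' := exists_isLamRun hL h
  rw [lamPMF, dif_pos h']
  exact h'.choose_spec

/-- The `λ`-run through the string `w`, one symbol after the other. The outcome `(p, y, r)` with
`y ≠ []` means that the run stops in state `p` with `y` in place of a symbol of `w`, below which
`r` is left; the outcome `(p, [], [])` means that `w` is removed. -/
noncomputable def stringRun (th : Finset (List G)) (d : Q → Option S → G → Q → List G → ℝ≥0) :
    Q → List G → PMF (Q × List G × List G)
  | q, [] => PMF.pure (q, [], [])
  | q, c :: w => (lamPMF th d (q, [c])).bind fun x =>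
      match x with
      | (p, []) => stringRun th d p w
      | (p, b :: y) => PMF.pure (p, b :: y, w)

/-- The properties of an outcome of `stringRun`. -/
structure StringRunOutcome (th : Finset (List G)) (d : Q → Option S → G → Q → List G → ℝ≥0)
    (q : Q) (w : List G) (o : Q × List G × List G) : Prop where
  reach : LamReach d (q, w) (o.1, o.2.1 ++ o.2.2)
  halted : ∀ a z, o.2.1 = a :: z → total th d o.1 none a ≠ 1
  suffix : o.2.2 <:+ w
  origin : o.2.1 ≠ [] → o.2.2.length < w.length ∧
    ∃ p c, LamTerm d (p, [c]) ∧ LamReach d (p, [c]) (o.1, o.2.1)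
  removed : o.2.1 = [] → o.2.2 = []

/-- The run removes symbols of `w` one by one until the run from one of them stops with a nonempty
string. Hence this string comes from a single symbol, and the remainder is a proper suffix of `w`.
-/
theorem stringRun_outcome {th : Finset (List G)} {d : Q → Option S → G → Q → List G → ℝ≥0}
    (hL : ∀ q a, total th d q none a ≤ 1) (w : List G) :
    ∀ {q : Q}, LamTerm d (q, w) → ∀ o ∈ (stringRun th d q w).support,
      StringRunOutcome th d q w o := by
  induction w with
  | nil =>
    intro q _ o ho
    simp only [stringRun, PMF.support_pure, Set.mem_singleton_iff] at ho
    subst ho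
    exact ⟨.refl, by simp, by simp, by simp, by simp⟩
  | cons c w ih =>
    intro q hT o ho
    have hT1 : LamTerm d (q, [c]) := LamTerm.of_append (w := w) hT
    have hrun := isLamRun_lamPMF hL hT1
    rw [stringRun, PMF.mem_support_bind_iff] at ho
    obtain ⟨⟨p, y⟩, hx, ho⟩ := ho
    have hr := hrun.reach _ hx
    have hr' : LamReach d (q, c :: w) (p, y ++ w) := hr.append w
    cases y with
    | nil =>
      have hh := ih (hT.reach hr') o ho
      exact ⟨hr'.trans hh.reach, hh.halted, hh.suffix.trans (List.suffix_cons _ _), fun hy =>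
        ⟨(hh.origin hy).1.trans (by simp), (hh.origin hy).2⟩, hh.removed⟩
    | cons b y =>
      simp only [PMF.support_pure, Set.mem_singleton_iff] at ho
      subst ho
      refine ⟨hr', ?_, List.suffix_cons _ _, fun _ => ⟨by simp, q, c, hT1, hr⟩, by simp⟩
      exact hrun.halted _ hx

/-- Only the removal of all of `w` exposes `z`; any other outcome is a final stop. So the value is
`V` on `z` in the first case and the payoff in the second. -/
theorem stringRun_value {th : Finset (List G)} {d : Q → Option S → G → Q → List G → ℝ≥0}
    (hL : ∀ q a, total th d q none a ≤ 1) {V W : Q → List G → ℝ≥0∞} (hV : IsLamValue th d V W)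
    (z w : List G) :
    ∀ {q : Q}, LamTerm d (q, w) → V q (w ++ z) = expect (stringRun th d q w) fun o =>
      if o.2.1 = [] then V o.1 z else W o.1 (o.2.1 ++ o.2.2 ++ z) := by
  induction w with
  | nil => intro q _; simp [stringRun, expect_pure]
  | cons c w ih =>
    intro q hT
    have hT1 : LamTerm d (q, [c]) := LamTerm.of_append (w := w) hT
    have hrun := isLamRun_lamPMF hL hT1
    rw [stringRun, expect_bind]
    -- The run from the single symbol `c` is valued with `w ++ z` kept below. Emptying the stack
    -- then pays `V p (w ++ z)`, which the induction hypothesis evaluates.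
    have := hrun.value (fun p y => V p (y ++ (w ++ z)))
      (fun p y => if y = [] then V p (w ++ z) else W p (y ++ (w ++ z))) (by simp)
      ⟨fun p a v => by simpa using hV.cons p a (v ++ (w ++ z))⟩
    simp only [List.cons_append, List.nil_append] at this ⊢
    rw [this]
    refine expect_congr _ fun x hx => ?_
    obtain ⟨p, y⟩ := x
    cases y with
    | nil =>
      simp only [if_true]
      exact ih (hT.reach ((hrun.reach _ hx).append w))
    | cons b y => simp [expect_pure]

open scoped Classical in
/-- The distribution of the moves reading `s`, given that no `λ`-move is made. -/
noncomputable def readPMF (th : Finset (List G)) (d : Q → Option S → G → Q → List G → ℝ≥0)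
    (q : Q) (s : S) (a : G) : PMF (Q × List G) :=
  if h : ∃ μ : PMF (Q × List G), ∀ x,
    ((1 - total th d q none a : ℝ≥0) : ℝ≥0∞) * μ x = d q (some s) a x.1 x.2
  then h.choose else PMF.pure (q, [])

/-- `1 - δ[q,λ,a]` is the total probability of reading `s`, so conditioning on reading is division
by it. If it vanishes, both sides are 0 for any distribution. -/
theorem readPMF_spec {th : Finset (List G)} {d : Q → Option S → G → Q → List G → ℝ≥0}
    (hth : ∀ q s a p u, d q s a p u ≠ 0 → u ∈ th) {q : Q} {s : S} {a : G}
    (h : total th d q (some s) a + total th d q none a = 1) (x : Q × List G) :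
    ((1 - total th d q none a : ℝ≥0) : ℝ≥0∞) * readPMF th d q s a x
      = d q (some s) a x.1 x.2 := by
  have hT : total th d q (some s) a = 1 - total th d q none a := eq_tsub_of_add_eq h
  have hex : ∃ μ : PMF (Q × List G), ∀ x,
      ((1 - total th d q none a : ℝ≥0) : ℝ≥0∞) * μ x = d q (some s) a x.1 x.2 := by
    rw [← hT]
    by_cases h0 : total th d q (some s) a = 0
    · refine ⟨PMF.pure (q, []), fun x => ?_⟩
      have : d q (some s) a x.1 x.2 = 0 := by
        by_contra hne
        rw [total, Finset.sum_eq_zero_iff] at h0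
        exact hne (Finset.sum_eq_zero_iff.1 (h0 x.1 (Finset.mem_univ _)) x.2 (hth _ _ _ _ _ hne))
      simp [h0, this]
    · refine ⟨PMF.ofFinset (fun x => ((d q (some s) a x.1 x.2 / total th d q (some s) a : ℝ≥0) :
        ℝ≥0∞)) (Finset.univ ×ˢ th) ?_ ?_, fun x => ?_⟩
      · rw [← ENNReal.ofNNReal_finsetSum, Finset.sum_product, ENNReal.coe_eq_one]
        simp only [← Finset.sum_div]
        exact div_self h0
      · intro x hx
        have : d q (some s) a x.1 x.2 = 0 := by
          by_contra hne
          exact hx (by simpa using hth _ _ _ _ _ hne)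
        simp [this]
      · rw [PMF.ofFinset_apply, ← ENNReal.coe_mul, mul_div_cancel₀ _ h0]
  rw [readPMF, dif_pos hex]
  exact hex.choose_spec x

end Runs

/-! ### The machine in ideal shape and its local properties -/

section IdealMachine

variable {S Q G : Type*}

/-- Strings of length at most `L`. -/
abbrev Block (G : Type*) (L : ℕ) := {l : List G // l.length ≤ L}

/-- The string `l`, cut off at length `L`. -/
def Block.trunc (L : ℕ) (l : List G) : Block G L := ⟨l.take L, List.length_take_le _ _⟩

theorem Block.trunc_val {L : ℕ} {l : List G} (h : l.length ≤ L) : (Block.trunc L l).1 = l :=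
  List.take_of_length_le h

/-- A block as a function that gives its symbols. -/
def Block.get {L : ℕ} (b : Block G L) : Fin L → Option G := fun i => b.1[(i : ℕ)]?

theorem Block.get_injective {L : ℕ} : Function.Injective (Block.get (G := G) (L := L)) := by
  intro b b' h
  apply Subtype.ext
  apply List.ext_getElem?
  intro i
  by_cases hi : i < L
  · exact congrFun h ⟨i, hi⟩
  · rw [List.getElem?_eq_none (b.2.trans (by omega)), List.getElem?_eq_none (b'.2.trans (by omega))]

noncomputable instance [Fintype G] (L : ℕ) : Fintype (Block G L) :=
  Fintype.ofInjective _ Block.get_injective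

theorem Block.card_le [Fintype G] (L : ℕ) :
    Fintype.card (Block G L) ≤ (Fintype.card G + 1) ^ L := by
  have := Fintype.card_le_of_injective _ (Block.get_injective (G := G) (L := L))
  simpa using this

/-- The states of the machine in ideal shape. A state `inl (q, y, t)` stands for a situation with
`y` and `t` on top of the stack in which no `λ`-move is made; a state `inr q` for one in which
a `λ`-run goes on with the topmost block of the stack. -/
abbrev IState (Q G : Type*) (L₁ L₂ : ℕ) := (Q × Block G L₁ × Block G L₂) ⊕ Q

/-- The stack symbols of the machine in ideal shape: blocks, and the bottom marker `none`. -/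
abbrev ISym (G : Type*) (L₂ : ℕ) := Option (Block G L₂)

variable {L₁ L₂ : ℕ}

/-- The strings that the machine in ideal shape may write. -/
noncomputable def idealTheta (G : Type*) [Fintype G] (L₂ : ℕ) : Finset (List (ISym G L₂)) :=
  open scoped Classical in
  {[]} ∪ Finset.univ.image (fun X => [X]) ∪
    Finset.univ.image (fun X : ISym G L₂ × ISym G L₂ => [X.1, X.2])

theorem nil_mem_idealTheta [Fintype G] : [] ∈ idealTheta G L₂ := by simp [idealTheta]

theorem singleton_mem_idealTheta [Fintype G] (X : ISym G L₂) : [X] ∈ idealTheta G L₂ := by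
  simp [idealTheta]

theorem pair_mem_idealTheta [Fintype G] (X Y : ISym G L₂) : [X, Y] ∈ idealTheta G L₂ := by
  simp [idealTheta]

/-- The move that pops a block, given the outcome of the `λ`-run through this block. -/
def popTo (o : Q × List G × List G) : IState Q G L₁ L₂ × List (ISym G L₂) :=
  if o.2.1 = [] then (Sum.inr o.1, [])
  else (Sum.inl (o.1, Block.trunc L₁ o.2.1, Block.trunc L₂ o.2.2), [])

theorem popTo_snd (o : Q × List G × List G) : (popTo o : IState Q G L₁ L₂ × _).2 = [] := by
  unfold popTo; split_ifs <;> rfl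

/-- The move for an outcome of a `λ`-run that stops above the topmost block `X`. -/
def place (t : Block G L₂) (X : ISym G L₂) (o : Q × List G × List G) :
    IState Q G L₁ L₂ × List (ISym G L₂) :=
  -- In this case `t` is untouched and becomes a block of its own, while the symbols above it stay
  -- in the state. Otherwise the remainder is no longer than `t` and fits into the state.
  if t.1.length < o.2.2.length then
    (Sum.inl (o.1, Block.trunc L₁ o.2.1,
      Block.trunc L₂ (o.2.2.take (o.2.2.length - t.1.length))), [some t, X])
  else (Sum.inl (o.1, Block.trunc L₁ o.2.1, Block.trunc L₂ o.2.2), [X])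

/-- The stack content that a stack of blocks stands for. -/
def flat (Xs : List (ISym G L₂)) : List G := Xs.flatMap fun X => X.elim [] Subtype.val

@[simp] theorem flat_nil : flat ([] : List (ISym G L₂)) = [] := rfl

@[simp] theorem flat_some (v : Block G L₂) (Xs : List (ISym G L₂)) :
    flat (some v :: Xs) = v.1 ++ flat Xs := rfl

@[simp] theorem flat_none (Xs : List (ISym G L₂)) : flat (none :: Xs) = flat Xs := rfl

variable [Fintype Q] (th : Finset (List G)) (d : Q → Option S → G → Q → List G → ℝ≥0) (H : Set Q)

/-- The move after the `λ`-run through the strings kept in the state. -/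
noncomputable def afterRun (t : Block G L₂) (X : ISym G L₂) (o : Q × List G × List G) :
    PMF (IState Q G L₁ L₂ × List (ISym G L₂)) :=
  if o.2.1 = [] then
    match X with
    | none => PMF.pure (Sum.inr o.1, [none])
    -- The run through the next block belongs to the same reading move. Postponing it to a `λ`-move
    -- would make the reading move stationary, and no `λ`-move may follow a stationary move.
    | some v => (stringRun th d o.1 v.1).map popTo
  else PMF.pure (place t X o)

/-- The distribution of the reading moves in the state `inl (q, y, t)`. -/
noncomputable def readMove (q : Q) (y : Block G L₁) (t : Block G L₂) (s : S) (X : ISym G L₂) :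
    PMF (IState Q G L₁ L₂ × List (ISym G L₂)) :=
  match y.1 with
  -- A default, never used in a corresponding configuration, that keeps the total probability equal
  -- to 1.
  | [] => PMF.pure (Sum.inl (q, y, t), [X])
  | a :: y' => (readPMF th d q s a).bind fun x =>
      (stringRun th d x.1 (x.2 ++ y' ++ t.1)).bind (afterRun th d t X)

open scoped Classical in
/-- The distribution of the moves of the machine in ideal shape; `none` if there are no moves. -/
noncomputable def idealMove : IState Q G L₁ L₂ → Option S → ISym G L₂ →
    Option (PMF (IState Q G L₁ L₂ × List (ISym G L₂)))
  | Sum.inl (q, y, t), some s, X => if q ∈ H then none else some (readMove th d q y t s X)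
  | Sum.inl _, none, _ => none
  | Sum.inr q, none, some v => some ((stringRun th d q v.1).map popTo)
  | Sum.inr _, none, none => none
  | Sum.inr _, some _, some _ => none
  -- Another default for the probability requirement: with the bottom marker alone the simulated
  -- stack would be empty, which never happens.
  | Sum.inr q, some _, none => some (PMF.pure (Sum.inr q, [none]))

/-- The transition probabilities of the machine in ideal shape. -/
noncomputable def idealDelta (x : IState Q G L₁ L₂) (s : Option S) (X : ISym G L₂)
    (x' : IState Q G L₁ L₂) (u : List (ISym G L₂)) : ℝ≥0 :=
  (idealMove th d H x s X).elim 0 fun μ => (μ (x', u)).toNNReal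

variable {th d H}

theorem idealDelta_ne_zero {x : IState Q G L₁ L₂} {s : Option S} {X : ISym G L₂}
    {x' : IState Q G L₁ L₂} {u : List (ISym G L₂)} :
    idealDelta th d H x s X x' u ≠ 0 ↔
      ∃ μ, idealMove th d H x s X = some μ ∧ (x', u) ∈ μ.support := by
  rw [idealDelta]
  cases h : idealMove th d H x s X with
  | none => simp
  | some μ => simp [PMF.mem_support_iff, ENNReal.toNNReal_eq_zero_iff, PMF.apply_ne_top]

theorem idealMove_lam {x : IState Q G L₁ L₂} {X : ISym G L₂} {μ} {x' u}
    (h : idealMove th d H x none X = some μ) (hu : (x', u) ∈ μ.support) : X ≠ none ∧ u = [] := by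
  rcases x with ⟨q, y, t⟩ | q
  · simp [idealMove] at h
  · cases X with
    | none => simp [idealMove] at h
    | some v =>
      simp only [idealMove, Option.some.injEq] at h
      subst h
      simp only [PMF.mem_support_map_iff] at hu
      obtain ⟨o, -, ho⟩ := hu
      refine ⟨by simp, ?_⟩
      have := popTo_snd (L₁ := L₁) (L₂ := L₂) o
      rw [ho] at this
      exact this

/-- Pushing leads to a state `inl`, which has no `λ`-moves. A stationary move leads either to such a
state or to a state `inr` above the bottom marker, where there is no `λ`-move either. -/
theorem idealMove_read {x : IState Q G L₁ L₂} {s : S} {X : ISym G L₂} {μ} {x' u}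
    (h : idealMove th d H x (some s) X = some μ) (hu : (x', u) ∈ μ.support) :
    (u = [] ∧ X ≠ none) ∨ (u = [X] ∧ idealMove th d H x' none X = none) ∨
      ∃ b, b ≠ none ∧ u = [b, X] ∧ idealMove th d H x' none b = none := by
  rcases x with ⟨q, y, t⟩ | q
  · simp only [idealMove] at h
    split_ifs at h with hq
    simp only [Option.some.injEq] at h
    subst h
    unfold readMove at hu
    split at hu
    · simp only [PMF.support_pure, Set.mem_singleton_iff, Prod.mk.injEq] at hu
      obtain ⟨rfl, rfl⟩ := hu
      exact Or.inr (Or.inl ⟨rfl, rfl⟩)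
    · simp only [PMF.mem_support_bind_iff] at hu
      obtain ⟨x, -, o, -, hu⟩ := hu
      unfold afterRun at hu
      split_ifs at hu with h1
      · cases X with
        | none =>
          simp only [PMF.support_pure, Set.mem_singleton_iff, Prod.mk.injEq] at hu
          obtain ⟨rfl, rfl⟩ := hu
          exact Or.inr (Or.inl ⟨rfl, rfl⟩)
        | some v =>
          simp only [PMF.mem_support_map_iff] at hu
          obtain ⟨o, -, ho⟩ := hu
          have := popTo_snd (L₁ := L₁) (L₂ := L₂) o
          rw [ho] at this
          exact Or.inl ⟨this, by simp⟩
      · simp only [PMF.support_pure, Set.mem_singleton_iff] at hu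
        unfold place at hu
        split_ifs at hu
        · simp only [Prod.mk.injEq] at hu
          obtain ⟨rfl, rfl⟩ := hu
          exact Or.inr (Or.inr ⟨some t, by simp, rfl, rfl⟩)
        · simp only [Prod.mk.injEq] at hu
          obtain ⟨rfl, rfl⟩ := hu
          exact Or.inr (Or.inl ⟨rfl, rfl⟩)
  · cases X with
    | some v => simp [idealMove] at h
    | none =>
      simp only [idealMove, Option.some.injEq] at h
      subst h
      simp only [PMF.support_pure, Set.mem_singleton_iff, Prod.mk.injEq] at hu
      obtain ⟨rfl, rfl⟩ := hu
      exact Or.inr (Or.inl ⟨rfl, rfl⟩)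

variable [Fintype G]

theorem idealMove_mem_theta {x : IState Q G L₁ L₂} {s : Option S} {X : ISym G L₂} {μ}
    (h : idealMove th d H x s X = some μ) : ∀ a ∈ μ.support, a.2 ∈ idealTheta G L₂ := by
  rintro ⟨x', u⟩ hu
  cases s with
  | none => rw [(idealMove_lam h hu).2]; exact nil_mem_idealTheta
  | some s =>
    rcases idealMove_read h hu with h | h | ⟨b, -, h, -⟩
    · rw [h.1]; exact nil_mem_idealTheta
    · rw [h.1]; exact singleton_mem_idealTheta _
    · rw [h]; exact pair_mem_idealTheta _ _

theorem sum_idealDelta {x : IState Q G L₁ L₂} {s : Option S} {X : ISym G L₂} {μ}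
    (h : idealMove th d H x s X = some μ)
    (f : IState Q G L₁ L₂ → List (ISym G L₂) → ℝ≥0∞) :
    ∑ x', ∑ u ∈ idealTheta G L₂, (idealDelta th d H x s X x' u : ℝ≥0∞) * f x' u
      = expect μ fun a => f a.1 a.2 := by
  rw [← expect_eq_sum μ _ (idealMove_mem_theta h)]
  simp [idealDelta, h]

theorem sum_idealDelta_none {x : IState Q G L₁ L₂} {s : Option S} {X : ISym G L₂}
    (h : idealMove th d H x s X = none)
    (f : IState Q G L₁ L₂ → List (ISym G L₂) → ℝ≥0∞) :
    ∑ x', ∑ u ∈ idealTheta G L₂, (idealDelta th d H x s X x' u : ℝ≥0∞) * f x' u = 0 := by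
  simp [idealDelta, h]

theorem total_idealDelta {x : IState Q G L₁ L₂} {s : Option S} {X : ISym G L₂} {μ}
    (h : idealMove th d H x s X = some μ) :
    total (idealTheta G L₂) (idealDelta th d H) x s X = 1 := by
  have h1 := sum_idealDelta h fun _ _ => 1
  have h2 : expect μ (fun _ => 1) = 1 := by simp [expect, PMF.tsum_coe]
  rw [h2] at h1
  rw [← ENNReal.coe_eq_one, total]
  push_cast
  simpa using h1

theorem total_idealDelta_none {x : IState Q G L₁ L₂} {s : Option S} {X : ISym G L₂}
    (h : idealMove th d H x s X = none) :
    total (idealTheta G L₂) (idealDelta th d H) x s X = 0 := by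
  simp [total, idealDelta, h]

theorem idealDelta_prob {x : IState Q G L₁ L₂} (hx : ∀ q y t, x = Sum.inl (q, y, t) → q ∉ H)
    (s : S) (X : ISym G L₂) :
    total (idealTheta G L₂) (idealDelta th d H) x (some s) X +
      total (idealTheta G L₂) (idealDelta th d H) x none X = 1 := by
  rcases x with ⟨q, y, t⟩ | q
  · rw [total_idealDelta (μ := readMove th d q y t s X) (by simp [idealMove, hx q y t rfl]),
      total_idealDelta_none rfl, add_zero]
  · cases X with
    | none => rw [total_idealDelta rfl, total_idealDelta_none rfl, add_zero]
    | some v => rw [total_idealDelta_none rfl, total_idealDelta rfl, zero_add]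

theorem idealConditions_idealDelta :
    IdealConditions (idealTheta G L₂) none
      (idealDelta (L₁ := L₁) (L₂ := L₂) th d H) where
  read_move x s X x' u h := by
    obtain ⟨μ, hμ, hu⟩ := idealDelta_ne_zero.1 h
    rcases idealMove_read hμ hu with h | h | ⟨b, hb, h, -⟩
    · exact Or.inl h.1
    · exact Or.inr (Or.inl h.1)
    · exact Or.inr (Or.inr ⟨b, hb, h⟩)
  lam_move x X x' u h := by
    obtain ⟨μ, hμ, hu⟩ := idealDelta_ne_zero.1 h
    exact idealMove_lam hμ hu
  after_push x s X x' b hb h := by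
    obtain ⟨μ, hμ, hu⟩ := idealDelta_ne_zero.1 h
    rcases idealMove_read hμ hu with h | h | ⟨b', -, h, h'⟩
    · simp at h
    · simp at h
    · simp only [List.cons.injEq, and_true] at h
      subst h
      exact total_idealDelta_none h'
  after_stationary x s X x' h := by
    obtain ⟨μ, hμ, hu⟩ := idealDelta_ne_zero.1 h
    rcases idealMove_read hμ hu with h | h | ⟨b', -, h, -⟩
    · simp at h
    · exact total_idealDelta_none h.2
    · simp at h

end IdealMachine

/-! ### Correctness of the simulation -/

section Simulation

variable {S Q G : Type*} [Fintype Q]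

/-- The value, for the payoff `f` on the final states, of a situation in which no further
`λ`-move is made before the next symbol is read. -/
noncomputable def readValue (th : Finset (List G)) (d : Q → Option S → G → Q → List G → ℝ≥0)
    (H : Set Q) (fin : Config S Q G → ℝ≥0) (f : Q → ℝ≥0) : List S → Q → List G → ℝ≥0∞ :=
  open scoped Classical in fun rest q z =>
  match rest, z with
  | [], _ => f q
  | _ :: _, [] => 0
  | s :: rest, a :: z =>
    if q ∈ H then f q
    else expect (readPMF th d q s a) fun x => weight th d fin x.1 rest (x.2 ++ z)

/-- A machine with transition function `d` and halting states `H`, together with a set `R` of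
configurations that is closed under moves and bounds for the strings that occur in `λ`-runs. -/
structure Simulable (th : Finset (List G)) (d : Q → Option S → G → Q → List G → ℝ≥0)
    (H : Set Q) (L₁ L₂ : ℕ) (R : Config S Q G → Prop) : Prop where
  theta : ∀ q s a p u, d q s a p u ≠ 0 → u ∈ th
  lam_le_one : ∀ q a, total th d q none a ≤ 1
  halt : ∀ q s a p u, q ∈ H → d q s a p u = 0
  prob : ∀ q, q ∉ H → ∀ s a, total th d q (some s) a + total th d q none a = 1
  length_run : ∀ q c p y, LamTerm d (q, [c]) → LamReach d (q, [c]) (p, y) → y.length ≤ L₁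
  length_write : ∀ q s a p u, d q s a p u ≠ 0 → u.length + L₁ ≤ L₂ + 2
  step : ∀ c c', R c → Follows d c c' → R c'
  term : ∀ c, R c → LamTerm d (c.1, c.2.2)
  stack_ne_nil : ∀ c, R c → c.2.2 ≠ []

variable {th : Finset (List G)} {d : Q → Option S → G → Q → List G → ℝ≥0} {H : Set Q}
  {L₁ L₂ : ℕ} {R : Config S Q G → Prop}

theorem Simulable.reach (h : Simulable th d H L₁ L₂ R) {c c' : Config S Q G} (hc : R c)
    (hr : Relation.ReflTransGen (Follows d) c c') : R c' := by
  induction hr with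
  | refl => exact hc
  | tail _ hs ih => exact h.step _ _ ih hs

/-- The payoff `readValue` is conditional on no `λ`-move being made. Multiplied by `1 - δ[q,λ,a]` it
gives the reading part of the one-step equation, or the stopping part when the tape is exhausted or
the state is halting. -/
theorem Simulable.isLamValue (h : Simulable th d H L₁ L₂ R) {fin : Config S Q G → ℝ≥0}
    {f : Q → ℝ≥0} (hfin : ∀ q rest a z, fin (q, rest, a :: z) =
      open scoped Classical in if rest = [] ∨ q ∈ H then (1 - total th d q none a) * f q else 0)
    (rest : List S) :
    IsLamValue th d (fun q z => weight th d fin q rest z) (readValue th d H fin f rest) where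
  cons q a z := by
    cases rest with
    | nil => simp [weight_cons_nil, hfin, readValue]
    | cons s rest =>
      rw [weight_cons_cons, hfin]
      by_cases hq : q ∈ H
      · simp [readValue, hq, h.halt q (some s) a _ _ hq]
      · simp only [reduceCtorEq, hq, or_self, if_false, readValue, ENNReal.coe_zero, zero_add]
        rw [add_comm]
        congr 1
        rw [expect, ← ENNReal.tsum_mul_left]
        simp only [← mul_assoc, readPMF_spec h.theta (h.prob q hq s a)]
        rw [← Finset.sum_product' Finset.univ th
          (fun p u => (d q (some s) a p u : ℝ≥0∞) * weight th d fin p rest (u ++ z))]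
        refine (tsum_eq_sum fun x hx => ?_).symm
        by_cases h0 : d q (some s) a x.1 x.2 = 0
        · simp [h0]
        · simp [h.theta _ _ _ _ _ h0] at hx

/-- The configurations of the machine in ideal shape that correspond to configurations in `R`. -/
def Corresponds (th : Finset (List G)) (d : Q → Option S → G → Q → List G → ℝ≥0)
    (R : Config S Q G → Prop) (c : Config S (IState Q G L₁ L₂) (ISym G L₂)) : Prop :=
  (∃ vs : List (Block G L₂), c.2.2 = vs.map some ++ [none]) ∧
  match c.1 with
  | Sum.inl (q, y, t) => (∃ a y', y.1 = a :: y' ∧ total th d q none a ≠ 1) ∧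
      R (q, c.2.1, y.1 ++ t.1 ++ flat c.2.2)
  | Sum.inr q => R (q, c.2.1, flat c.2.2)

/-- The value of a corresponding configuration. -/
noncomputable def correspValue (V W : List S → Q → List G → ℝ≥0∞)
    (c : Config S (IState Q G L₁ L₂) (ISym G L₂)) : ℝ≥0∞ :=
  match c.1 with
  | Sum.inl (q, y, t) => W c.2.1 q (y.1 ++ t.1 ++ flat c.2.2)
  | Sum.inr q => V c.2.1 q (flat c.2.2)

theorem popTo_corresponds (h : Simulable th d H L₁ L₂ R) {q : Q} {v : Block G L₂}
    {rest : List S} {Xs : List (ISym G L₂)} (hR : R (q, rest, v.1 ++ flat Xs))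
    (hXs : ∃ vs : List (Block G L₂), Xs = vs.map some ++ [none])
    (V W : List S → Q → List G → ℝ≥0∞)
    {o : Q × List G × List G} (ho : o ∈ (stringRun th d q v.1).support) :
    Corresponds th d R ((popTo o : IState Q G L₁ L₂ × _).1, rest,
      (popTo o : IState Q G L₁ L₂ × _).2 ++ Xs) ∧
    correspValue V W ((popTo o : IState Q G L₁ L₂ × _).1, rest,
      (popTo o : IState Q G L₁ L₂ × _).2 ++ Xs) =
      if o.2.1 = [] then V rest o.1 (flat Xs) else W rest o.1 (o.2.1 ++ o.2.2 ++ flat Xs) := by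
  have hT : LamTerm d (q, v.1) := LamTerm.of_append (h.term _ hR)
  have hO := stringRun_outcome h.lam_le_one _ hT o ho
  have hR' : R (o.1, rest, o.2.1 ++ o.2.2 ++ flat Xs) :=
    h.reach hR (LamReach.follows (LamReach.append hO.reach (flat Xs)) rest)
  by_cases ho1 : o.2.1 = []
  · simp only [popTo, ho1, if_true, List.nil_append]
    rw [ho1, hO.removed ho1] at hR'
    exact ⟨⟨hXs, hR'⟩, rfl⟩
  · obtain ⟨-, p, c, hT', hr⟩ := hO.origin ho1
    have h1 : o.2.1.length ≤ L₁ := h.length_run _ _ _ _ hT' hr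
    have h2 : o.2.2.length ≤ L₂ := hO.suffix.length_le.trans v.2
    simp only [popTo, ho1, if_false, List.nil_append, Corresponds, correspValue,
      Block.trunc_val h1, Block.trunc_val h2]
    refine ⟨⟨hXs, ?_, hR'⟩, trivial⟩
    obtain ⟨a, y', hy⟩ := List.exists_cons_of_ne_nil ho1
    exact ⟨a, y', hy, hO.halted a y' hy⟩

/-- Truncation loses nothing here: the string on top has at most `L₁` symbols, and the part of the
remainder kept in the state at most `L₂`. -/
theorem place_corresponds (h : Simulable th d H L₁ L₂ R) {q : Q} {w : List G} {t : Block G L₂}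
    {rest : List S} {X : ISym G L₂} {Xs : List (ISym G L₂)}
    (hR : R (q, rest, w ++ t.1 ++ flat (X :: Xs))) (hw : w.length ≤ L₂ + 1)
    (hXs : ∃ vs : List (Block G L₂), X :: Xs = vs.map some ++ [none])
    (V W : List S → Q → List G → ℝ≥0∞)
    {o : Q × List G × List G} (ho : o ∈ (stringRun th d q (w ++ t.1)).support)
    (ho1 : o.2.1 ≠ []) :
    Corresponds th d R ((place t X o : IState Q G L₁ L₂ × _).1, rest,
      (place t X o : IState Q G L₁ L₂ × _).2 ++ Xs) ∧
    correspValue V W ((place t X o : IState Q G L₁ L₂ × _).1, rest,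
      (place t X o : IState Q G L₁ L₂ × _).2 ++ Xs) =
      W rest o.1 (o.2.1 ++ o.2.2 ++ flat (X :: Xs)) := by
  have hT : LamTerm d (q, w ++ t.1) := LamTerm.of_append (h.term _ hR)
  have hO := stringRun_outcome h.lam_le_one _ hT o ho
  have hR' : R (o.1, rest, o.2.1 ++ o.2.2 ++ flat (X :: Xs)) :=
    h.reach hR (LamReach.follows (LamReach.append hO.reach (flat (X :: Xs))) rest)
  obtain ⟨hlt, p, c, hT', hr⟩ := hO.origin ho1
  have h1 : o.2.1.length ≤ L₁ := h.length_run _ _ _ _ hT' hr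
  obtain ⟨a, y', hy⟩ := List.exists_cons_of_ne_nil ho1
  have hst : ∃ a y', o.2.1 = a :: y' ∧ total th d o.1 none a ≠ 1 := ⟨a, y', hy, hO.halted a y' hy⟩
  rw [List.length_append] at hlt
  by_cases hl : t.1.length < o.2.2.length
  · have h2 : (o.2.2.take (o.2.2.length - t.1.length)).length ≤ L₂ := by
      rw [List.length_take]; omega
    have hsuf : t.1 <:+ o.2.2 :=
      List.suffix_of_suffix_length_le (List.suffix_append w t.1) hO.suffix hl.le
    have h3 : o.2.2.take (o.2.2.length - t.1.length) ++ t.1 = o.2.2 := by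
      obtain ⟨r, hr⟩ := hsuf
      rw [← hr]
      simp
    simp only [place, hl, if_true, Corresponds, correspValue, Block.trunc_val h1,
      Block.trunc_val h2, List.cons_append, List.nil_append]
    have h4 : o.2.1 ++ o.2.2.take (o.2.2.length - t.1.length) ++ flat (some t :: X :: Xs) =
        o.2.1 ++ o.2.2 ++ flat (X :: Xs) := by
      conv_rhs => rw [← h3]
      rw [flat_some]
      simp only [List.append_assoc]
    rw [h4]
    obtain ⟨vs, hvs⟩ := hXs
    exact ⟨⟨⟨t :: vs, by simp [hvs]⟩, hst, hR'⟩, rfl⟩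
  · have h2 : o.2.2.length ≤ L₂ := (not_lt.1 hl).trans t.2
    simp only [place, hl, if_false, List.cons_append, List.nil_append, Corresponds, correspValue,
      Block.trunc_val h1, Block.trunc_val h2]
    exact ⟨⟨hXs, hst, hR'⟩, trivial⟩

theorem afterRun_corresponds (h : Simulable th d H L₁ L₂ R) {q : Q} {w : List G} {t : Block G L₂}
    {rest : List S} {X : ISym G L₂} {Xs : List (ISym G L₂)}
    (hR : R (q, rest, w ++ t.1 ++ flat (X :: Xs))) (hw : w.length ≤ L₂ + 1)
    (hXs : ∃ vs : List (Block G L₂), X :: Xs = vs.map some ++ [none])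
    {V W : List S → Q → List G → ℝ≥0∞} (hV : IsLamValue th d (V rest) (W rest))
    {o : Q × List G × List G} (ho : o ∈ (stringRun th d q (w ++ t.1)).support) :
    (∀ a ∈ (afterRun th d t X o : PMF (IState Q G L₁ L₂ × _)).support,
      Corresponds th d R (a.1, rest, a.2 ++ Xs)) ∧
    expect (afterRun th d t X o : PMF (IState Q G L₁ L₂ × _))
      (fun a => correspValue V W (a.1, rest, a.2 ++ Xs)) =
      if o.2.1 = [] then V rest o.1 (flat (X :: Xs))
      else W rest o.1 (o.2.1 ++ o.2.2 ++ flat (X :: Xs)) := by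
  by_cases ho1 : o.2.1 = []
  · have hT : LamTerm d (q, w ++ t.1) := LamTerm.of_append (h.term _ hR)
    have hO := stringRun_outcome h.lam_le_one _ hT o ho
    have hR' : R (o.1, rest, o.2.1 ++ o.2.2 ++ flat (X :: Xs)) :=
      h.reach hR (LamReach.follows (LamReach.append hO.reach (flat (X :: Xs))) rest)
    rw [ho1, hO.removed ho1] at hR'
    obtain ⟨vs, hvs⟩ := hXs
    cases vs with
    | nil =>
      simp only [List.map_nil, List.nil_append, List.cons.injEq] at hvs
      obtain ⟨rfl, rfl⟩ := hvs
      -- Everything would be removed above the bottom marker `none`, so the simulated stack would be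
      -- empty, which `R` excludes.
      exact absurd rfl (h.stack_ne_nil _ hR')
    | cons v vs =>
      simp only [List.map_cons, List.cons_append, List.cons.injEq] at hvs
      obtain ⟨rfl, rfl⟩ := hvs
      simp only [flat_some, List.nil_append] at hR'
      have hp := fun o' ho' => popTo_corresponds h hR' ⟨vs, rfl⟩ V W (o := o') ho'
      simp only [afterRun, ho1, if_true]
      constructor
      · intro a ha
        rw [PMF.mem_support_map_iff] at ha
        obtain ⟨o', ho', rfl⟩ := ha
        exact (hp o' ho').1
      · rw [expect_map, flat_some, stringRun_value h.lam_le_one hV _ _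
          (LamTerm.of_append (h.term _ hR'))]
        exact expect_congr _ fun o' ho' => (hp o' ho').2
  · have hp := place_corresponds h hR hw hXs V W ho ho1
    simp only [afterRun, ho1, if_false]
    refine ⟨fun a ha => ?_, ?_⟩
    · simp only [PMF.support_pure, Set.mem_singleton_iff] at ha
      rw [ha]
      exact hp.1
    · rw [expect_pure]
      exact hp.2

/-- After reading, the string above `t` is `x.2 ++ y'` with `|y'| ≤ L₁ - 1`; with `length_write` its
length is at most `L₂ + 1`. The value equation is that of the string run through `x.2 ++ y' ++ t`.
-/
theorem readMove_corresponds (h : Simulable th d H L₁ L₂ R) {q : Q} (hq : q ∉ H)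
    {y : Block G L₁} {t : Block G L₂} {s : S} {rest : List S} {X : ISym G L₂}
    {Xs : List (ISym G L₂)}
    (hc : Corresponds th d R ((Sum.inl (q, y, t) : IState Q G L₁ L₂), s :: rest, X :: Xs))
    {fin : Config S Q G → ℝ≥0} {f : Q → ℝ≥0} (hfin : ∀ q rest a z, fin (q, rest, a :: z) =
      open scoped Classical in if rest = [] ∨ q ∈ H then (1 - total th d q none a) * f q else 0) :
    (∀ a ∈ (readMove th d q y t s X).support, Corresponds th d R (a.1, rest, a.2 ++ Xs)) ∧
    expect (readMove th d q y t s X) (fun a => correspValue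
        (fun rest q z => weight th d fin q rest z) (readValue th d H fin f)
        (a.1, rest, a.2 ++ Xs)) =
      readValue th d H fin f (s :: rest) q (y.1 ++ t.1 ++ flat (X :: Xs)) := by
  obtain ⟨hXs, ⟨a, y', hy, hL⟩, hR⟩ := hc
  simp only at hXs hR
  have hlen : y'.length + 1 ≤ L₁ := by simpa [hy] using y.2
  have hpos : (1 - total th d q none a : ℝ≥0) ≠ 0 :=
    (tsub_pos_of_lt (lt_of_le_of_ne (h.lam_le_one q a) hL)).ne'
  have hstep : ∀ x ∈ (readPMF th d q s a).support,
      R (x.1, rest, (x.2 ++ y') ++ t.1 ++ flat (X :: Xs)) ∧ (x.2 ++ y').length ≤ L₂ + 1 := by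
    intro x hx
    have hd : d q (some s) a x.1 x.2 ≠ 0 := by
      have := readPMF_spec h.theta (h.prob q hq s a) x
      intro h0
      rw [h0, ENNReal.coe_zero, mul_eq_zero] at this
      rcases this with h' | h'
      · exact hpos (ENNReal.coe_eq_zero.1 h')
      · exact (PMF.mem_support_iff _ _).1 hx h'
    constructor
    · refine h.step _ _ hR ?_
      have := Follows.read (d := d) q s a x.1 x.2 rest (y' ++ t.1 ++ flat (X :: Xs)) hd
      simpa [hy] using this
    · have := h.length_write _ _ _ _ _ hd
      rw [List.length_append]
      omega
  have hV := h.isLamValue hfin rest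
  have key := fun x hx => fun o ho => afterRun_corresponds h (hstep x hx).1 (hstep x hx).2 hXs
    (V := fun rest q z => weight th d fin q rest z) (W := readValue th d H fin f) hV (o := o) ho
  have hrm : readMove th d q y t s X = (readPMF th d q s a).bind fun x =>
      (stringRun th d x.1 (x.2 ++ y' ++ t.1)).bind (afterRun th d t X) := by
    unfold readMove
    split
    · rename_i h0; rw [hy] at h0; cases h0
    · rename_i h0; rw [hy] at h0; cases h0; rfl
  rw [hrm]
  constructor
  · intro b hb
    simp only [PMF.mem_support_bind_iff] at hb
    obtain ⟨x, hx, o, ho, hb⟩ := hb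
    exact (key x hx o ho).1 b hb
  · rw [expect_bind, hy]
    simp only [List.cons_append, readValue, hq, if_false]
    refine expect_congr _ fun x hx => ?_
    rw [expect_bind, expect_congr _ fun o ho => (key x hx o ho).2]
    have hT : LamTerm d (x.1, x.2 ++ y' ++ t.1) := LamTerm.of_append (h.term _ (hstep x hx).1)
    have := stringRun_value h.lam_le_one hV (flat (X :: Xs)) _ hT
    rw [← this]
    simp only [List.append_assoc]

theorem corresponds_of_follows (h : Simulable th d H L₁ L₂ R)
    {c c' : Config S (IState Q G L₁ L₂) (ISym G L₂)} (hc : Corresponds th d R c)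
    (hs : Follows (idealDelta th d H) c c') : Corresponds th d R c' := by
  rcases hs with ⟨x, X, x', u, rest, Xs, hd⟩ | ⟨x, s, X, x', u, rest, Xs, hd⟩
  · obtain ⟨μ, hμ, hu⟩ := idealDelta_ne_zero.1 hd
    rcases x with ⟨q, y, t⟩ | q
    · simp [idealMove] at hμ
    · cases X with
      | none => simp [idealMove] at hμ
      | some v =>
        simp only [idealMove, Option.some.injEq] at hμ
        subst hμ
        rw [PMF.mem_support_map_iff] at hu
        obtain ⟨o, ho, hou⟩ := hu
        obtain ⟨⟨vs, hvs⟩, hR⟩ := hc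
        have hXs : ∃ vs : List (Block G L₂), Xs = vs.map some ++ [none] := by
          cases vs with
          | nil => simp at hvs
          | cons v' vs => exact ⟨vs, by simpa using (List.cons.inj hvs).2⟩
        -- Only the correspondence is needed, so the value functions are dummies.
        have := (popTo_corresponds h (by simpa using hR) hXs (fun _ _ _ => 0) (fun _ _ _ => 0)
          ho).1
        rwa [hou] at this
  · obtain ⟨μ, hμ, hu⟩ := idealDelta_ne_zero.1 hd
    rcases x with ⟨q, y, t⟩ | q
    · simp only [idealMove] at hμ
      split_ifs at hμ with hq
      simp only [Option.some.injEq] at hμ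
      subst hμ
      exact (readMove_corresponds h hq hc (f := fun _ => 0)
        (fin := fun _ => 0) (by simp)).1 _ hu
    · cases X with
      | some v => simp [idealMove] at hμ
      | none =>
        obtain ⟨⟨vs, hvs⟩, hR⟩ := hc
        cases vs with
        | nil =>
          simp only [List.map_nil, List.nil_append, List.cons.injEq, true_and] at hvs
          subst hvs
          exact absurd rfl (h.stack_ne_nil _ hR)
        | cons v vs => simp at hvs

/-- Every move of the machine in ideal shape decreases this quantity. -/
def potential {Q G : Type*} (c : Config S Q G) : ℕ := 2 * c.2.1.length + c.2.2.length

/-- Reading costs 2 and raises the stack by at most 1; a `λ`-move pops. -/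
theorem potential_lt {c c' : Config S (IState Q G L₁ L₂) (ISym G L₂)}
    (hs : Follows (idealDelta th d H) c c') : potential c' < potential c := by
  rcases hs with ⟨x, X, x', u, rest, Xs, hd⟩ | ⟨x, s, X, x', u, rest, Xs, hd⟩
  · obtain ⟨μ, hμ, hu⟩ := idealDelta_ne_zero.1 hd
    simp [potential, (idealMove_lam hμ hu).2]
  · obtain ⟨μ, hμ, hu⟩ := idealDelta_ne_zero.1 hd
    rcases idealMove_read hμ hu with h | h | ⟨b, -, h, -⟩
    · simp only [potential, h.1, List.nil_append, List.length_cons]; omega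
    · simp only [potential, h.1, List.cons_append, List.nil_append, List.length_cons]; omega
    · simp only [potential, h, List.cons_append, List.nil_append, List.length_cons]; omega

theorem noInfinitePath_idealDelta (c : Config S (IState Q G L₁ L₂) (ISym G L₂)) :
    NoInfinitePath (idealDelta th d H) c := by
  rintro ⟨g, -, hg⟩
  exact (WellFounded.not_rel_apply_succ (r := (· < ·)) (fun k => potential (g k))).elim
    fun k hk => hk (potential_lt (hg k))

/-- Induction on the potential. In a state `inl` the one-step equation of the new machine is that of
`readMove_corresponds`, or the payoff if the tape is empty or the state is halting. In a state `inr`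
a `λ`-move is certain, and `stringRun_value` for the topmost block matches it. -/
theorem weight_idealDelta [Fintype G] (h : Simulable th d H L₁ L₂ R)
    {fin : Config S Q G → ℝ≥0} {f : Q → ℝ≥0} (hfin : ∀ q rest a z, fin (q, rest, a :: z) =
      open scoped Classical in if rest = [] ∨ q ∈ H then (1 - total th d q none a) * f q else 0)
    {fin' : Config S (IState Q G L₁ L₂) (ISym G L₂) → ℝ≥0}
    (hinl : ∀ q y t rest X Xs, fin' (Sum.inl (q, y, t), rest, X :: Xs) =
      open scoped Classical in if rest = [] ∨ q ∈ H then f q else 0)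
    (hinr : ∀ q rest v Xs, fin' (Sum.inr q, rest, some v :: Xs) = 0) (k : ℕ) :
    ∀ c : Config S (IState Q G L₁ L₂) (ISym G L₂), potential c < k → Corresponds th d R c →
      weight (idealTheta G L₂) (idealDelta th d H) fin' c.1 c.2.1 c.2.2 =
        correspValue (fun rest q z => weight th d fin q rest z) (readValue th d H fin f) c := by
  induction k with
  | zero => intro c hc; omega
  | succ k ih =>
    rintro ⟨x, rest, Xs⟩ hk hc
    have hXs := hc.1
    obtain ⟨vs, hvs⟩ := hXs
    simp only at hvs
    obtain ⟨X, Xs, rfl⟩ : ∃ X Xs', Xs = X :: Xs' := by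
      apply List.exists_cons_of_ne_nil
      rw [hvs]; simp
    have ih' : ∀ c', Follows (idealDelta th d H) (x, rest, X :: Xs) c' →
        weight (idealTheta G L₂) (idealDelta th d H) fin' c'.1 c'.2.1 c'.2.2 =
        correspValue (fun rest q z => weight th d fin q rest z) (readValue th d H fin f) c' :=
      fun c' hc' => ih c' (by have := potential_lt hc'; omega) (corresponds_of_follows h hc hc')
    rcases x with ⟨q, y, t⟩ | q
    · cases rest with
      | nil =>
        simp only
        rw [weight_cons_nil, sum_idealDelta_none rfl, hinl]
        simp [correspValue, readValue]
      | cons s rest =>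
        simp only
        rw [weight_cons_cons, sum_idealDelta_none rfl, hinl, zero_add]
        by_cases hq : q ∈ H
        · rw [sum_idealDelta_none (by simp [idealMove, hq])]
          have hne : y.1 ++ t.1 ++ flat (X :: Xs) ≠ [] := h.stack_ne_nil _ hc.2.2
          obtain ⟨a, z, haz⟩ := List.exists_cons_of_ne_nil hne
          simp only [correspValue, haz]
          simp [readValue, hq]
        · have hμ : idealMove th d H (Sum.inl (q, y, t)) (some s) X =
              some (readMove th d q y t s X) := by simp [idealMove, hq]
          rw [sum_idealDelta hμ]
          simp only [reduceCtorEq, hq, or_self, if_false, ENNReal.coe_zero, zero_add]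
          refine Eq.trans ?_ (readMove_corresponds h hq hc hfin).2
          refine expect_congr _ fun a ha => ih' (a.1, rest, a.2 ++ Xs) ?_
          exact Follows.read _ _ _ _ _ _ _ (idealDelta_ne_zero.2 ⟨_, hμ, ha⟩)
    · cases vs with
      | nil =>
        simp only [List.map_nil, List.nil_append, List.cons.injEq] at hvs
        obtain ⟨rfl, rfl⟩ := hvs
        exact absurd rfl (h.stack_ne_nil _ hc.2)
      | cons v vs =>
        simp only [List.map_cons, List.cons_append, List.cons.injEq] at hvs
        obtain ⟨rfl, rfl⟩ := hvs
        have hμ : idealMove th d H (Sum.inr q : IState Q G L₁ L₂) none (some v) =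
          some ((stringRun th d q v.1).map popTo) := rfl
        have hR : R (q, rest, v.1 ++ flat (vs.map some ++ [none])) := hc.2
        have hw : weight (idealTheta G L₂) (idealDelta th d H) fin' (Sum.inr q) rest
            (some v :: (vs.map some ++ [none])) =
            expect ((stringRun th d q v.1).map (popTo (L₁ := L₁) (L₂ := L₂))) fun a =>
              weight (idealTheta G L₂) (idealDelta th d H) fin' a.1 rest
                (a.2 ++ (vs.map some ++ [none])) := by
          cases rest with
          | nil => rw [weight_cons_nil, sum_idealDelta hμ, hinr]; simp
          | cons s rest =>
            rw [weight_cons_cons, sum_idealDelta hμ, hinr, sum_idealDelta_none rfl]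
            simp
        simp only
        rw [hw, expect_congr _ fun a ha => ih' (a.1, rest, a.2 ++ (vs.map some ++ [none]))
          (Follows.lam _ _ _ _ _ _ (idealDelta_ne_zero.2 ⟨_, hμ, ha⟩)), expect_map,
          expect_congr _ fun o ho => (popTo_corresponds h hR ⟨vs, rfl⟩ _ _ ho).2]
        exact (stringRun_value h.lam_le_one (h.isLamValue hfin rest) _ _
          (LamTerm.of_append (h.term _ hR))).symm

end Simulation

/-! ### Length bounds, the start configuration and the bottom marker -/

section Common

variable {S Q G : Type*}

/-- Bound for the strings that replace a single symbol in a `λ`-run. -/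
def runBound (e k : ℕ) : ℕ := 1 + (e - 1) * (k - 1)

/-- Bound for the blocks. -/
def blockBound (e k : ℕ) : ℕ := (e - 1) * k

/-- This fixes the block size: a written string of length at most `e` and a rest of at most
`runBound e k - 1` symbols make at most `blockBound e k + 1` symbols, at least one of which the run
consumes or replaces. -/
theorem add_runBound {e k : ℕ} (he : 0 < e) (hk : 0 < k) :
    e + runBound e k = blockBound e k + 2 := by
  obtain ⟨e, rfl⟩ := Nat.exists_eq_add_of_lt he
  obtain ⟨k, rfl⟩ := Nat.exists_eq_add_of_lt hk
  simp only [runBound, blockBound, zero_add, Nat.add_sub_cancel]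
  ring

/-- On a stack reached from the initial one the bottom marker occurs at the bottom and nowhere
else. -/
theorem Core.stack_form (M : Core S Q G) {d : Q → Option S → G → Q → List G → ℝ≥0}
    (hd : ∀ q s a p u, d q s a p u ≠ 0 → M.delta q s a p u ≠ 0) {x : List S}
    {c : Config S Q G} (hr : Relation.ReflTransGen (Follows d) (M.q0, x, [M.Z0]) c) :
    ∃ v, M.Z0 ∉ v ∧ c.2.2 = v ++ [M.Z0] := by
  have aux : ∀ q s a p u z, M.delta q s a p u ≠ 0 → (∃ v, M.Z0 ∉ v ∧ a :: z = v ++ [M.Z0]) →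
      ∃ v, M.Z0 ∉ v ∧ u ++ z = v ++ [M.Z0] := by
    rintro q s a p u z hne ⟨v, hv, h⟩
    cases v with
    | nil =>
      simp only [List.nil_append, List.cons.injEq] at h
      obtain ⟨rfl, rfl⟩ := h
      simpa using M.delta_of_bottom q s p u hne
    | cons b v =>
      simp only [List.cons_append, List.cons.injEq] at h
      obtain ⟨rfl, rfl⟩ := h
      simp only [List.mem_cons, not_or] at hv
      have := M.delta_of_ne_bottom q s a p u hne (Ne.symm hv.1)
      exact ⟨u ++ v, by simp [this, hv.2], by simp⟩
  induction hr with
  | refl => exact ⟨[], by simp, rfl⟩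
  | tail _ hs ih =>
    rcases hs with ⟨q, a, p, u, rest, z, h⟩ | ⟨q, s, a, p, u, rest, z, h⟩
    · exact aux _ _ _ _ _ _ (hd _ _ _ _ _ h) ih
    · exact aux _ _ _ _ _ _ (hd _ _ _ _ _ h) ih

/-- The state of the machine in ideal shape that stands for the state `q` with nothing but the
bottom marker `Z` on the stack. -/
def startState (q : Q) (Z : G) (L₁ L₂ : ℕ) : IState Q G L₁ L₂ :=
  Sum.inl (q, Block.trunc L₁ [Z], Block.trunc L₂ [])

/-- The states `inl (q, y, t)` with `q ∈ F`. -/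
def liftStates (L₁ L₂ : ℕ) (F : Set Q) : Set (IState Q G L₁ L₂) :=
  {x | ∃ q y t, x = Sum.inl (q, y, t) ∧ q ∈ F}

@[simp] theorem inl_mem_liftStates {L₁ L₂ : ℕ} {F : Set Q} {q : Q} {y : Block G L₁}
    {t : Block G L₂} : Sum.inl (q, y, t) ∈ (liftStates L₁ L₂ F : Set (IState Q G L₁ L₂)) ↔
      q ∈ F := by
  refine ⟨?_, fun h => ⟨q, y, t, rfl, h⟩⟩
  rintro ⟨q', y', t', h, hq⟩
  cases h
  exact hq

@[simp] theorem inr_notMem_liftStates {L₁ L₂ : ℕ} {F : Set Q} {q : Q} :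
    Sum.inr q ∉ (liftStates L₁ L₂ F : Set (IState Q G L₁ L₂)) := by
  simp [liftStates]

theorem disjoint_liftStates {L₁ L₂ : ℕ} {F F' : Set Q} (h : Disjoint F F') :
    Disjoint (liftStates L₁ L₂ F : Set (IState Q G L₁ L₂)) (liftStates L₁ L₂ F') := by
  rw [Set.disjoint_left] at h ⊢
  rintro _ ⟨q, y, t, rfl, hq⟩ hq'
  exact h hq (inl_mem_liftStates.1 hq')

variable [Fintype Q]

theorem delta_eq_zero_of_total {th : Finset (List G)}
    {d : Q → Option S → G → Q → List G → ℝ≥0} {q : Q} {s : Option S} {a : G}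
    (h : total th d q s a = 0) (p : Q) {u : List G} (hu : u ∈ th) : d q s a p u = 0 := by
  rw [total, Finset.sum_eq_zero_iff] at h
  exact Finset.sum_eq_zero_iff.1 (h p (Finset.mem_univ _)) u hu

theorem IsLamValue.eq_of_total {th : Finset (List G)}
    {d : Q → Option S → G → Q → List G → ℝ≥0} {V W : Q → List G → ℝ≥0∞}
    (h : IsLamValue th d V W) {q : Q} {a : G} (h0 : total th d q none a = 0) (z : List G) :
    V q (a :: z) = W q (a :: z) := by
  rw [h.cons, h0, Finset.sum_eq_zero fun p _ => Finset.sum_eq_zero fun u hu => by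
    rw [delta_eq_zero_of_total h0 p hu]; simp]
  simp

theorem corresponds_startState {th : Finset (List G)}
    {d : Q → Option S → G → Q → List G → ℝ≥0} {R : Config S Q G → Prop} {q : Q} {Z : G}
    {L₁ L₂ : ℕ} (hL : 1 ≤ L₁) {x : List S} (h0 : total th d q none Z = 0) (hR : R (q, x, [Z])) :
    Corresponds th d R (startState q Z L₁ L₂, x, [none]) := by
  have h1 : (Block.trunc L₁ [Z]).1 = [Z] := Block.trunc_val (by simpa using hL)
  have h2 : (Block.trunc L₂ ([] : List G)).1 = [] := Block.trunc_val (by simp)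
  refine ⟨⟨[], rfl⟩, ?_⟩
  simp only [startState, h1, h2]
  exact ⟨⟨Z, [], rfl, by simp [h0]⟩, by simpa using hR⟩

/-- As no `λ`-move is possible at the start, the initial situation already counts as one in which a
`λ`-move has been declined, and a state `inl` represents it. -/
theorem Simulable.weight_start [Fintype G] {th : Finset (List G)}
    {d : Q → Option S → G → Q → List G → ℝ≥0} {R : Config S Q G → Prop} {H : Set Q} {L₁ L₂ : ℕ}
    (h : Simulable th d H L₁ L₂ R) (hL : 1 ≤ L₁)
    {fin : Config S Q G → ℝ≥0} {f : Q → ℝ≥0} (hfin : ∀ q rest a z, fin (q, rest, a :: z) =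
      open scoped Classical in if rest = [] ∨ q ∈ H then (1 - total th d q none a) * f q else 0)
    {fin' : Config S (IState Q G L₁ L₂) (ISym G L₂) → ℝ≥0}
    (hinl : ∀ q y t rest X Xs, fin' (Sum.inl (q, y, t), rest, X :: Xs) =
      open scoped Classical in if rest = [] ∨ q ∈ H then f q else 0)
    (hinr : ∀ q rest v Xs, fin' (Sum.inr q, rest, some v :: Xs) = 0)
    {q : Q} {Z : G} {x : List S} (h0 : total th d q none Z = 0) (hR : R (q, x, [Z])) :
    weight th d fin q x [Z] =
      weight (idealTheta G L₂) (idealDelta th d H) fin' (startState q Z L₁ L₂) x [none] := by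
  have h1 : (Block.trunc L₁ [Z]).1 = [Z] := Block.trunc_val (by simpa using hL)
  have h2 : (Block.trunc L₂ ([] : List G)).1 = [] := Block.trunc_val (by simp)
  have := weight_idealDelta h hfin hinl hinr _ (startState q Z L₁ L₂, x, [none])
    (Nat.lt_succ_self _) (corresponds_startState hL h0 hR)
  simp only at this
  rw [this, (h.isLamValue hfin x).eq_of_total h0]
  simp [correspValue, startState, h1, h2]

theorem idealDelta_of_ne_bottom {th : Finset (List G)}
    {d : Q → Option S → G → Q → List G → ℝ≥0} {H : Set Q} {L₁ L₂ : ℕ} {x : IState Q G L₁ L₂}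
    {s : Option S} {X : ISym G L₂} {x' : IState Q G L₁ L₂} {u : List (ISym G L₂)}
    (h : idealDelta th d H x s X x' u ≠ 0) (hX : X ≠ none) : none ∉ u := by
  obtain ⟨μ, hμ, hu⟩ := idealDelta_ne_zero.1 h
  cases s with
  | none => simp [(idealMove_lam hμ hu).2]
  | some s =>
    rcases idealMove_read hμ hu with h | h | ⟨b, hb, h, -⟩
    · simp [h.1]
    · simp [h.1, hX.symm]
    · simp [h, hX.symm, hb.symm]

theorem idealDelta_of_bottom {th : Finset (List G)}
    {d : Q → Option S → G → Q → List G → ℝ≥0} {H : Set Q} {L₁ L₂ : ℕ} {x : IState Q G L₁ L₂}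
    {s : Option S} {x' : IState Q G L₁ L₂} {u : List (ISym G L₂)}
    (h : idealDelta th d H x s none x' u ≠ 0) : ∃ v, none ∉ v ∧ u = v ++ [none] := by
  obtain ⟨μ, hμ, hu⟩ := idealDelta_ne_zero.1 h
  cases s with
  | none => exact absurd rfl (idealMove_lam hμ hu).1
  | some s =>
    rcases idealMove_read hμ hu with h | h | ⟨b, hb, h, -⟩
    · exact absurd rfl h.2
    · exact ⟨[], by simp, h.1⟩
    · exact ⟨[b], by simp [hb.symm], h⟩

theorem idealDelta_mem_theta [Fintype G] {th : Finset (List G)}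
    {d : Q → Option S → G → Q → List G → ℝ≥0} {H : Set Q} {L₁ L₂ : ℕ} {x : IState Q G L₁ L₂}
    {s : Option S} {X : ISym G L₂} {x' : IState Q G L₁ L₂} {u : List (ISym G L₂)}
    (h : idealDelta th d H x s X x' u ≠ 0) : u ∈ idealTheta G L₂ := by
  obtain ⟨μ, hμ, hu⟩ := idealDelta_ne_zero.1 h
  exact idealMove_mem_theta hμ _ hu

end Common

/-! ### The model with endmarkers -/

section EndmarkerModel

variable {A Q G : Type*} [Fintype Q] [Fintype G]

theorem Endmarker.simulable (M : Endmarker A Q G) {e : ℕ} (he : 0 < e)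
    (hth : ∀ u ∈ M.theta, u.length ≤ e) :
    Simulable M.theta M.delta (M.acc ∪ M.rej)
      (runBound e (Fintype.card Q * Fintype.card G))
      (blockBound e (Fintype.card Q * Fintype.card G))
      (fun c => ∃ x, Relation.ReflTransGen (Follows M.delta) (M.q0, endmarked x, [M.Z0]) c) where
  theta := M.mem_theta
  lam_le_one q a := by
    by_cases hq : q ∈ M.acc ∪ M.rej
    · simp [total, M.delta_halt q _ _ _ _ hq]
    · rw [← M.prob q hq Tape.left a]
      exact le_add_self
  halt := M.delta_halt
  prob := M.prob
  length_run q c p y hT hr := length_le_of_lamReach_card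
    (fun q s a p u h => hth u (M.mem_theta q s a p u h)) hT hr
  length_write q s a p u h := by
    have hk : 0 < Fintype.card Q * Fintype.card G :=
      Nat.mul_pos (Fintype.card_pos_iff.2 ⟨q⟩) (Fintype.card_pos_iff.2 ⟨a⟩)
    rw [← add_runBound he hk]
    exact Nat.add_le_add_right (hth u (M.mem_theta q s a p u h)) _
  step := by
    rintro c c' ⟨x, hx⟩ hs
    exact ⟨x, hx.tail hs⟩
  term := by
    rintro c ⟨x, hx⟩
    exact lamTerm_of_noInfinitePath (M.no_infinite_path x) hx
  stack_ne_nil := by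
    rintro c ⟨x, hx⟩
    obtain ⟨v, -, hv⟩ := M.stack_form (fun _ _ _ _ _ h => h) hx
    simp [hv]

/-- The machine in ideal shape in the model with endmarkers. -/
noncomputable def Endmarker.ideal (M : Endmarker A Q G) {e : ℕ} (he : 0 < e)
    (hth : ∀ u ∈ M.theta, u.length ≤ e) :
    Endmarker A (IState Q G (runBound e (Fintype.card Q * Fintype.card G))
      (blockBound e (Fintype.card Q * Fintype.card G)))
      (ISym G (blockBound e (Fintype.card Q * Fintype.card G))) where
  theta := idealTheta G _
  nil_mem_theta := nil_mem_idealTheta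
  delta := idealDelta M.theta M.delta (M.acc ∪ M.rej)
  mem_theta _ _ _ _ _ h := idealDelta_mem_theta h
  q0 := startState M.q0 M.Z0 _ _
  Z0 := none
  acc := liftStates _ _ M.acc
  rej := liftStates _ _ M.rej
  disjoint_acc_rej := disjoint_liftStates M.disjoint_acc_rej
  delta_of_ne_bottom _ _ _ _ _ h hX := idealDelta_of_ne_bottom h hX
  delta_of_bottom _ _ _ _ h := idealDelta_of_bottom h
  delta_halt x s X x' u hx := by
    rcases x with ⟨q, y, t⟩ | q
    · have hq : q ∈ M.acc ∪ M.rej := by simpa using hx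
      cases s <;> simp [idealDelta, idealMove, hq]
    · simp at hx
  prob x hx s X := by
    refine idealDelta_prob ?_ s X
    rintro q y t rfl
    simpa using hx
  first_step := total_idealDelta_none rfl
  no_infinite_path _ := noInfinitePath_idealDelta _
  not_stuck x q a z hr hq := by
    have hs := M.simulable he hth
    have hc : Corresponds M.theta M.delta (fun c => ∃ x, Relation.ReflTransGen (Follows M.delta)
        (M.q0, endmarked x, [M.Z0]) c) (q, [], a :: z) := by
      have hc0 := corresponds_startState (L₁ := runBound e (Fintype.card Q * Fintype.card G))
        (L₂ := blockBound e (Fintype.card Q * Fintype.card G))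
        (R := fun c => ∃ x, Relation.ReflTransGen (Follows M.delta)
        (M.q0, endmarked x, [M.Z0]) c) (x := endmarked x) (by simp [runBound]) M.first_step
        ⟨x, .refl⟩
      exact Relation.ReflTransGen.head_induction_on (motive := fun c _ => Corresponds _ _ _ c →
        Corresponds _ _ _ _) hr id (fun hst _ ih hc => ih (corresponds_of_follows hs hc hst)) hc0
    rcases q with ⟨q, y, t⟩ | q
    · obtain ⟨-, ⟨b, y', hy, hL⟩, x, hR⟩ := hc
      simp only [hy, List.cons_append] at hR
      -- In a reachable non-halting situation with the tape read, `M` makes a `λ`-move with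
      -- probability 1, whereas a state `inl` stands for a situation where this probability is not
      -- 1.
      exact absurd (M.not_stuck x q b _ hR (by simpa using hq)) hL
    · obtain ⟨⟨vs, hvs⟩, hR⟩ := hc
      cases vs with
      | nil =>
        simp only [List.map_nil, List.nil_append, List.cons.injEq] at hvs
        obtain ⟨rfl, rfl⟩ := hvs
        exact absurd rfl (hs.stack_ne_nil _ hR)
      | cons v vs =>
        simp only [List.map_cons, List.cons_append, List.cons.injEq] at hvs
        obtain ⟨rfl, rfl⟩ := hvs
        exact total_idealDelta rfl

/-- The payoff is the indicator of `F`. It vanishes outside the halting states, and in these no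
`λ`-move is possible, so the factor `1 - δ[q,λ,a]` is 1. -/
theorem Endmarker.haltProb_ideal (M : Endmarker A Q G) {e : ℕ} (he : 0 < e)
    (hth : ∀ u ∈ M.theta, u.length ≤ e) {F : Set Q} (hF : F ⊆ M.acc ∪ M.rej) (x : List A) :
    M.haltProb F x = (M.ideal he hth).haltProb (liftStates _ _ F) x := by
  classical
  refine (M.simulable he hth).weight_start (f := fun q => if q ∈ F then 1 else 0)
    (by simp [runBound]) ?_ ?_ ?_ M.first_step ⟨x, .refl⟩
  · intro q rest a z
    by_cases hq : q ∈ F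
    · rw [if_pos (Or.inr (hF hq))]
      simp [hq, total, M.delta_halt q _ _ _ _ (hF hq)]
    · simp [hq]
  · intro q y t rest X Xs
    by_cases hq : q ∈ F
    · rw [if_pos (Or.inr (hF hq))]
      simp [hq]
    · simp [hq]
  · intro q rest v Xs
    simp

theorem Endmarker.errorEquivalent_ideal (M : Endmarker A Q G) {e : ℕ} (he : 0 < e)
    (hth : ∀ u ∈ M.theta, u.length ≤ e) : M.ErrorEquivalent (M.ideal he hth) := by
  have h1 : ∀ x, M.accProb x = (M.ideal he hth).accProb x :=
    M.haltProb_ideal he hth Set.subset_union_left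
  have h2 : ∀ x, M.rejProb x = (M.ideal he hth).rejProb x :=
    M.haltProb_ideal he hth Set.subset_union_right
  refine ⟨?_, fun x => ⟨h1 x, h2 x⟩⟩
  ext x
  simp [Endmarker.language, h1]

theorem Endmarker.idealShape_ideal (M : Endmarker A Q G) {e : ℕ} (he : 0 < e)
    (hth : ∀ u ∈ M.theta, u.length ≤ e) : (M.ideal he hth).IdealShape :=
  idealConditions_idealDelta

end EndmarkerModel

/-! ### The model without endmarkers, with the empty input treated separately -/

section NoEndmarkerModel

variable {A Q G : Type*}

open scoped Classical in
/-- The transition function in force on nonempty inputs. -/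
noncomputable def Core.deltaNonempty (M : Core A Q G) : Q → Option A → G → Q → List G → ℝ≥0 :=
  fun q s a p u => if q = M.q0 ∧ s = none ∧ a = M.Z0 then 0 else M.delta q s a p u

theorem Core.deltaOn_of_ne_nil (M : Core A Q G) {x : List A} (hx : x ≠ []) :
    M.deltaOn x = M.deltaNonempty := by
  funext q s a p u
  unfold Core.deltaOn Core.deltaNonempty
  by_cases h : q = M.q0 ∧ s = none ∧ a = M.Z0
  · rw [if_pos ⟨hx, h⟩, if_pos h]
  · rw [if_neg fun h' => h h'.2, if_neg h]

theorem Core.deltaOn_nil (M : Core A Q G) : M.deltaOn [] = M.delta := by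
  funext q s a p u
  simp [Core.deltaOn]

theorem Core.delta_ne_zero_of_deltaNonempty (M : Core A Q G) {q s a p u}
    (h : M.deltaNonempty q s a p u ≠ 0) : M.delta q s a p u ≠ 0 := by
  unfold Core.deltaNonempty at h
  split_ifs at h
  · exact absurd rfl h
  · exact h

/-- States with empty `y` serve as final states on the empty input. They differ from the start
state, so the special first `λ`-move is not available in them. -/
theorem inl_ne_startState {L₁ L₂ : ℕ} (hL : 1 ≤ L₁) (q q₀ : Q) (Z : G) :
    (Sum.inl (q, Block.trunc L₁ [], Block.trunc L₂ []) : IState Q G L₁ L₂) ≠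
      startState q₀ Z L₁ L₂ := by
  intro h
  simp only [startState, Sum.inl.injEq, Prod.mk.injEq, and_true] at h
  have := congrArg Subtype.val h.2
  rw [Block.trunc_val (by simp), Block.trunc_val (by simpa using hL)] at this
  simp at this

variable [Fintype Q]

theorem Core.total_deltaNonempty_start (M : Core A Q G) :
    total M.theta M.deltaNonempty M.q0 none M.Z0 = 0 := by
  simp [total, Core.deltaNonempty]

theorem Core.total_deltaNonempty (M : Core A Q G) {q : Q} {s : Option A} {a : G}
    (h : ¬ (q = M.q0 ∧ s = none ∧ a = M.Z0)) :
    total M.theta M.deltaNonempty q s a = total M.theta M.delta q s a := by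
  simp [total, Core.deltaNonempty, h]

theorem NoEndmarker.prob_deltaNonempty (M : NoEndmarker A Q G) (q : Q) (s : A) (a : G) :
    total M.theta M.deltaNonempty q (some s) a + total M.theta M.deltaNonempty q none a = 1 := by
  by_cases h : q = M.q0 ∧ a = M.Z0
  · obtain ⟨rfl, rfl⟩ := h
    rw [M.total_deltaNonempty_start, M.total_deltaNonempty (by simp), M.first_step, add_zero]
  · rw [M.total_deltaNonempty (by simp), M.total_deltaNonempty (by tauto), M.prob q s a h]

theorem NoEndmarker.total_none_le_one [Nonempty A] (M : NoEndmarker A Q G) (q : Q) (a : G) :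
    total M.theta M.delta q none a ≤ 1 := by
  by_cases h : q = M.q0 ∧ a = M.Z0
  · obtain ⟨rfl, rfl⟩ := h
    exact M.first_step_empty
  · rw [← M.prob q (Classical.arbitrary A) a h]
    exact le_add_self

/-- The distribution of the first move on the empty input. -/
noncomputable def NoEndmarker.emptyMove (M : NoEndmarker A Q G) (L₁ L₂ : ℕ) :
    PMF (IState Q G L₁ L₂ × List (ISym G L₂)) :=
  (lamPMF M.theta M.delta (M.q0, [M.Z0])).map fun o =>
    (Sum.inl (o.1, Block.trunc L₁ [], Block.trunc L₂ []), [none])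

open scoped Classical in
/-- The transition function of the machine in ideal shape in the model without endmarkers. -/
noncomputable def NoEndmarker.idealDelta (M : NoEndmarker A Q G) {L₁ L₂ : ℕ}
    (x : IState Q G L₁ L₂) (s : Option A) (X : ISym G L₂) (x' : IState Q G L₁ L₂)
    (u : List (ISym G L₂)) : ℝ≥0 :=
  if x = startState M.q0 M.Z0 L₁ L₂ ∧ s = none ∧ X = none then
    (M.emptyMove L₁ L₂ (x', u)).toNNReal
  else OnePPDA.idealDelta M.theta M.deltaNonempty ∅ x s X x' u

theorem NoEndmarker.emptyMove_support (M : NoEndmarker A Q G) {L₁ L₂ : ℕ}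
    {a : IState Q G L₁ L₂ × List (ISym G L₂)} (h : a ∈ (M.emptyMove L₁ L₂).support) :
    (∃ q, a.1 = Sum.inl (q, Block.trunc L₁ [], Block.trunc L₂ [])) ∧ a.2 = [none] := by
  rw [emptyMove, PMF.mem_support_map_iff] at h
  obtain ⟨o, -, rfl⟩ := h
  exact ⟨⟨_, rfl⟩, rfl⟩

theorem NoEndmarker.idealDelta_ne_zero (M : NoEndmarker A Q G) {L₁ L₂ : ℕ}
    {x : IState Q G L₁ L₂} {s : Option A} {X : ISym G L₂} {x' : IState Q G L₁ L₂}
    {u : List (ISym G L₂)} (h : M.idealDelta x s X x' u ≠ 0) :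
    (x = startState M.q0 M.Z0 L₁ L₂ ∧ s = none ∧ X = none ∧ (x', u) ∈ (M.emptyMove L₁ L₂).support) ∨
      OnePPDA.idealDelta M.theta M.deltaNonempty ∅ x s X x' u ≠ 0 := by
  unfold NoEndmarker.idealDelta at h
  split_ifs at h with h0
  · refine Or.inl ⟨h0.1, h0.2.1, h0.2.2, ?_⟩
    rw [PMF.mem_support_iff]
    intro h1
    simp [h1] at h
  · exact Or.inr h

/-- On the empty input the whole computation is one `λ`-run; since the bottom marker survives, it
ends with a nonempty stack and the indicator of `F` is the payoff. -/
theorem NoEndmarker.haltProb_nil [Nonempty A] (M : NoEndmarker A Q G) (F : Set Q) :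
    M.haltProb F [] = expect (lamPMF M.theta M.delta (M.q0, [M.Z0])) fun o =>
      open scoped Classical in if o.1 ∈ F then 1 else 0 := by
  classical
  have hT : LamTerm M.delta (M.q0, [M.Z0]) := by
    have := M.no_infinite_path []
    rw [M.deltaOn_nil] at this
    exact lamTerm_of_noInfinitePath this .refl
  have hrun := isLamRun_lamPMF M.total_none_le_one hT
  have hval := hrun.value (fun q z => weight M.theta M.delta (M.stopProb F []) q [] z)
    (fun q z => if z = [] then weight M.theta M.delta (M.stopProb F []) q [] z
      else if q ∈ F then 1 else 0) (by simp) ⟨fun q a z => by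
        rw [weight_cons_nil]
        congr 1
        by_cases hq : q ∈ F <;> simp [stopProb, M.deltaOn_nil, hq]⟩
  have h1 : M.haltProb F [] = weight M.theta M.delta (M.stopProb F []) M.q0 [] [M.Z0] := by
    rw [haltProb, M.deltaOn_nil]
    rfl
  rw [h1, hval]
  refine expect_congr _ fun o ho => ?_
  obtain ⟨v, -, hv⟩ := M.stack_form (x := []) (fun _ _ _ _ _ h => h)
    (LamReach.follows (hrun.reach o ho) [])
  simp only at hv
  simp [hv]

variable [Fintype G]

theorem NoEndmarker.simulable [Nonempty A] (M : NoEndmarker A Q G) {e : ℕ} (he : 0 < e)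
    (hth : ∀ u ∈ M.theta, u.length ≤ e) :
    Simulable M.theta M.deltaNonempty ∅
      (runBound e (Fintype.card Q * Fintype.card G))
      (blockBound e (Fintype.card Q * Fintype.card G))
      (fun c => ∃ x ≠ [], Relation.ReflTransGen (Follows M.deltaNonempty) (M.q0, x, [M.Z0]) c) where
  theta q s a p u h := M.mem_theta q s a p u (M.delta_ne_zero_of_deltaNonempty h)
  lam_le_one q a := by
    rw [← M.prob_deltaNonempty q (Classical.arbitrary A) a]
    exact le_add_self
  halt := by simp
  prob q _ s a := M.prob_deltaNonempty q s a
  length_run q c p y hT hr := length_le_of_lamReach_card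
    (fun q s a p u h => hth u (M.mem_theta q s a p u (M.delta_ne_zero_of_deltaNonempty h))) hT hr
  length_write q s a p u h := by
    have hk : 0 < Fintype.card Q * Fintype.card G :=
      Nat.mul_pos (Fintype.card_pos_iff.2 ⟨q⟩) (Fintype.card_pos_iff.2 ⟨a⟩)
    rw [← add_runBound he hk]
    exact Nat.add_le_add_right
      (hth u (M.mem_theta q s a p u (M.delta_ne_zero_of_deltaNonempty h))) _
  step := by
    rintro c c' ⟨x, hx, hr⟩ hs
    exact ⟨x, hx, hr.tail hs⟩
  term := by
    rintro c ⟨x, hx, hr⟩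
    have := M.no_infinite_path x
    rw [M.deltaOn_of_ne_nil hx] at this
    exact lamTerm_of_noInfinitePath this hr
  stack_ne_nil := by
    rintro c ⟨x, hx, hr⟩
    obtain ⟨v, -, hv⟩ := M.stack_form (fun _ _ _ _ _ h => M.delta_ne_zero_of_deltaNonempty h) hr
    simp [hv]

theorem NoEndmarker.total_idealDelta (M : NoEndmarker A Q G) {L₁ L₂ : ℕ}
    {x : IState Q G L₁ L₂} {s : Option A} {X : ISym G L₂}
    (h : ¬ (x = startState M.q0 M.Z0 L₁ L₂ ∧ s = none ∧ X = none)) :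
    total (idealTheta G L₂) M.idealDelta x s X =
      total (idealTheta G L₂) (OnePPDA.idealDelta M.theta M.deltaNonempty ∅) x s X := by
  simp [total, NoEndmarker.idealDelta, h]

theorem NoEndmarker.sum_idealDelta_start (M : NoEndmarker A Q G) {L₁ L₂ : ℕ}
    (f : IState Q G L₁ L₂ → List (ISym G L₂) → ℝ≥0∞) :
    ∑ x', ∑ u ∈ idealTheta G L₂,
      (M.idealDelta (startState M.q0 M.Z0 L₁ L₂) none none x' u : ℝ≥0∞) * f x' u =
      expect (M.emptyMove L₁ L₂) fun a => f a.1 a.2 := by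
  rw [← expect_eq_sum _ (idealTheta G L₂)]
  · simp [NoEndmarker.idealDelta]
  · intro a ha
    rw [(M.emptyMove_support ha).2]
    exact singleton_mem_idealTheta _

theorem NoEndmarker.total_idealDelta_start (M : NoEndmarker A Q G) (L₁ L₂ : ℕ) :
    total (idealTheta G L₂) M.idealDelta (startState M.q0 M.Z0 L₁ L₂) none none = 1 := by
  have h1 := M.sum_idealDelta_start (L₁ := L₁) (L₂ := L₂) fun _ _ => 1
  have h2 : expect (M.emptyMove L₁ L₂) (fun _ => 1) = 1 := by simp [expect, PMF.tsum_coe]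
  rw [h2] at h1
  rw [← ENNReal.coe_eq_one, total]
  push_cast
  simpa using h1

/-- The data of the machine in ideal shape in the model without endmarkers. -/
noncomputable def NoEndmarker.idealCore (M : NoEndmarker A Q G) (L₁ L₂ : ℕ) :
    Core A (IState Q G L₁ L₂) (ISym G L₂) where
  theta := idealTheta G _
  nil_mem_theta := nil_mem_idealTheta
  delta := M.idealDelta
  mem_theta x s X x' u h := by
    rcases M.idealDelta_ne_zero h with ⟨-, -, -, h⟩ | h
    · have := (M.emptyMove_support h).2
      simp only at this
      rw [this]
      exact singleton_mem_idealTheta _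
    · exact idealDelta_mem_theta h
  q0 := startState M.q0 M.Z0 _ _
  Z0 := none
  -- The states must be partitioned, so the states `inr` are put on one side. The choice has no
  -- effect, because above a block a `λ`-move from them is certain.
  acc := liftStates _ _ M.acc ∪ Set.range Sum.inr
  rej := liftStates _ _ M.rej
  disjoint_acc_rej := by
    rw [Set.disjoint_union_left]
    refine ⟨disjoint_liftStates M.disjoint_acc_rej, ?_⟩
    rw [Set.disjoint_left]
    rintro _ ⟨q, rfl⟩
    simp
  delta_of_ne_bottom x s X x' u h hX := by
    rcases M.idealDelta_ne_zero h with ⟨-, -, h, -⟩ | h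
    · exact absurd h hX
    · exact idealDelta_of_ne_bottom h hX
  delta_of_bottom x s x' u h := by
    rcases M.idealDelta_ne_zero h with ⟨-, -, -, h⟩ | h
    · exact ⟨[], by simp, (M.emptyMove_support h).2⟩
    · exact idealDelta_of_bottom h

theorem NoEndmarker.idealCore_deltaNonempty (M : NoEndmarker A Q G) (L₁ L₂ : ℕ) :
    (M.idealCore L₁ L₂).deltaNonempty = OnePPDA.idealDelta M.theta M.deltaNonempty ∅ := by
  funext x s X x' u
  by_cases h : x = startState M.q0 M.Z0 L₁ L₂ ∧ s = none ∧ X = none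
  · have h' : x = (M.idealCore L₁ L₂).q0 ∧ s = none ∧ X = (M.idealCore L₁ L₂).Z0 := h
    rw [Core.deltaNonempty, if_pos h']
    obtain ⟨rfl, rfl, rfl⟩ := h
    rfl
  · have h' : ¬ (x = (M.idealCore L₁ L₂).q0 ∧ s = none ∧ X = (M.idealCore L₁ L₂).Z0) := h
    rw [Core.deltaNonempty, if_neg h']
    exact if_neg h

/-- The machine in ideal shape in the model without endmarkers. -/
noncomputable def NoEndmarker.ideal (M : NoEndmarker A Q G) {L₁ : ℕ} (hL : 1 ≤ L₁) (L₂ : ℕ) :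
    NoEndmarker A (IState Q G L₁ L₂) (ISym G L₂) where
  toCore := M.idealCore L₁ L₂
  acc_union_rej := by
    refine Set.eq_univ_of_forall fun x => ?_
    rcases x with ⟨q, y, t⟩ | q
    · have : q ∈ M.acc ∪ M.rej := by rw [M.acc_union_rej]; trivial
      rcases this with h | h
      · exact Or.inl (Or.inl (inl_mem_liftStates.2 h))
      · exact Or.inr (inl_mem_liftStates.2 h)
    · exact Or.inl (Or.inr ⟨q, rfl⟩)
  prob x s X h := by
    have := idealDelta_prob (th := M.theta) (d := M.deltaNonempty) (H := ∅) (x := x) (by simp) s X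
    rw [← M.total_idealDelta (by simp), ← M.total_idealDelta (fun h' => h ⟨h'.1, h'.2.2⟩)] at this
    exact this
  first_step s := by
    have := idealDelta_prob (th := M.theta) (d := M.deltaNonempty) (H := ∅)
      (x := startState M.q0 M.Z0 L₁ L₂) (by simp) s none
    rw [total_idealDelta_none (s := none) rfl, add_zero, ← M.total_idealDelta (by simp)] at this
    exact this
  first_step_empty := (M.total_idealDelta_start L₁ L₂).le
  no_infinite_path x := by
    by_cases hx : x = []
    · subst hx
      rw [Core.deltaOn_nil]
      rintro ⟨g, h0, hg⟩
      -- On the empty input the first move draws the final state at once, and nothing can follow it.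
      have key : ∀ c, Follows M.idealDelta (startState M.q0 M.Z0 L₁ L₂, [], [none]) c →
          ∀ c', ¬ Follows M.idealDelta c c' := by
        intro c hc c' hc'
        generalize hs : (startState M.q0 M.Z0 L₁ L₂, ([] : List A), [(none : ISym G L₂)]) = c₀ at hc
        rcases hc with ⟨x, X, x', u, rest, Xs, hd⟩ | ⟨x, s, X, x', u, rest, Xs, hd⟩
        · simp only [Prod.mk.injEq, List.cons.injEq] at hs
          obtain ⟨rfl, rfl, rfl, rfl⟩ := hs
          rcases M.idealDelta_ne_zero hd with ⟨-, -, -, h⟩ | h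
          · obtain ⟨⟨q, hq⟩, hu⟩ := M.emptyMove_support h
            simp only at hq hu
            subst hq hu
            generalize hs : (_, ([] : List A), _) = c₁ at hc'
            rcases hc' with ⟨x, X, x', u, rest, Xs, hd⟩ | ⟨x, s, X, x', u, rest, Xs, hd⟩
            · simp only [Prod.mk.injEq] at hs
              obtain ⟨rfl, -⟩ := hs
              rcases M.idealDelta_ne_zero hd with ⟨h, -⟩ | h
              · exact inl_ne_startState hL _ _ _ h
              · exact h rfl
            · simp at hs
          · exact h rfl
        · simp at hs
      have h1 := hg 0
      rw [h0] at h1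
      exact key _ h1 _ (hg 1)
    · rw [Core.deltaOn_of_ne_nil _ hx, M.idealCore_deltaNonempty]
      exact noInfinitePath_idealDelta _

/-- The first `λ`-move has total probability 1, so the machine does not stop before it; afterwards
it stops with probability 1. -/
theorem NoEndmarker.haltProb_ideal_nil (M : NoEndmarker A Q G) {L₁ : ℕ} (hL : 1 ≤ L₁) (L₂ : ℕ)
    {F : Set Q} {F' : Set (IState Q G L₁ L₂)} (hF : ∀ q y t, Sum.inl (q, y, t) ∈ F' ↔ q ∈ F) :
    (M.ideal hL L₂).haltProb F' [] = expect (lamPMF M.theta M.delta (M.q0, [M.Z0])) fun o =>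
      open scoped Classical in if o.1 ∈ F then 1 else 0 := by
  classical
  have h1 : (M.ideal hL L₂).haltProb F' [] = weight (idealTheta G L₂) M.idealDelta
      ((M.ideal hL L₂).stopProb F' []) (startState M.q0 M.Z0 L₁ L₂) [] [none] := by
    rw [haltProb, Core.deltaOn_nil]
    rfl
  have h2 : ∀ x X Xs, (M.ideal hL L₂).stopProb F' [] (x, [], X :: Xs) =
      if x ∈ F' then 1 - total (idealTheta G L₂) M.idealDelta x none X else 0 := by
    intro x X Xs
    simp only [stopProb, Core.deltaOn_nil]
    rfl
  rw [h1, weight_cons_nil, h2, M.total_idealDelta_start, M.sum_idealDelta_start, emptyMove,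
    expect_map]
  simp only [tsub_self, ite_self, ENNReal.coe_zero, zero_add]
  congr 1
  funext o
  have h3 : ∀ x' u, M.idealDelta (Sum.inl (o.1, Block.trunc L₁ [], Block.trunc L₂ []))
      none none x' u = 0 := by
    intro x' u
    rw [NoEndmarker.idealDelta, if_neg fun h => inl_ne_startState hL _ _ _ h.1]
    rfl
  rw [List.singleton_append, weight_cons_nil, h2]
  by_cases hq : o.1 ∈ F <;> simp [h3, total, hF, hq]

theorem NoEndmarker.haltProb_ideal [Nonempty A] (M : NoEndmarker A Q G) {e : ℕ} (he : 0 < e)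
    (hth : ∀ u ∈ M.theta, u.length ≤ e)
    (hL : 1 ≤ runBound e (Fintype.card Q * Fintype.card G)) {F : Set Q}
    {F' : Set (IState Q G (runBound e (Fintype.card Q * Fintype.card G))
      (blockBound e (Fintype.card Q * Fintype.card G)))}
    (hF : ∀ q y t, Sum.inl (q, y, t) ∈ F' ↔ q ∈ F) (x : List A) :
    M.haltProb F x = (M.ideal hL _).haltProb F' x := by
  classical
  by_cases hx : x = []
  · subst hx
    rw [M.haltProb_nil, M.haltProb_ideal_nil hL _ hF]
  · have h1 : M.haltProb F x =
        weight M.theta M.deltaNonempty (M.stopProb F x) M.q0 x [M.Z0] := by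
      rw [haltProb, M.deltaOn_of_ne_nil hx]
      rfl
    have hd : (M.ideal hL (blockBound e (Fintype.card Q * Fintype.card G))).deltaOn x =
        OnePPDA.idealDelta M.theta M.deltaNonempty ∅ := by
      rw [Core.deltaOn_of_ne_nil _ hx]
      exact M.idealCore_deltaNonempty _ _
    have h2 : (M.ideal hL _).haltProb F' x = weight (idealTheta G _)
        (OnePPDA.idealDelta M.theta M.deltaNonempty ∅) ((M.ideal hL _).stopProb F' x)
        (startState M.q0 M.Z0 _ (blockBound e (Fintype.card Q * Fintype.card G))) x [none] := by
      rw [haltProb, hd]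
      rfl
    rw [h1, h2]
    refine (M.simulable he hth).weight_start hL (f := fun q => if q ∈ F then 1 else 0) ?_ ?_ ?_
      M.total_deltaNonempty_start ⟨x, hx, .refl⟩
    · intro q rest a z
      cases rest with
      | nil => simp [stopProb, M.deltaOn_of_ne_nil hx]
      | cons s rest => simp [stopProb]
    · intro q y t rest X Xs
      cases rest with
      | nil =>
        simp only [stopProb, hd, hF, true_or, if_true]
        have : total (M.ideal hL (blockBound e (Fintype.card Q * Fintype.card G))).theta
          (OnePPDA.idealDelta M.theta M.deltaNonempty ∅) (Sum.inl (q, y, t)) none X = 0 :=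
          total_idealDelta_none rfl
        rw [this, tsub_zero]
      | cons s rest => simp [stopProb]
    · intro q rest v Xs
      cases rest with
      | nil =>
        simp only [stopProb, hd]
        have : total (M.ideal hL (blockBound e (Fintype.card Q * Fintype.card G))).theta
          (OnePPDA.idealDelta M.theta M.deltaNonempty ∅)
          (Sum.inr q : IState Q G (runBound e (Fintype.card Q * Fintype.card G)) _)
          none (some v) = 1 :=
          OnePPDA.total_idealDelta rfl
        rw [this, tsub_self, ite_self]
      | cons s rest => simp [stopProb]

theorem NoEndmarker.errorEquivalent_ideal [Nonempty A] (M : NoEndmarker A Q G) {e : ℕ}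
    (he : 0 < e) (hth : ∀ u ∈ M.theta, u.length ≤ e)
    (hL : 1 ≤ runBound e (Fintype.card Q * Fintype.card G)) :
    M.ErrorEquivalent
      (M.ideal hL (blockBound e (Fintype.card Q * Fintype.card G))) := by
  have h1 : ∀ x, M.accProb x = (M.ideal hL _).accProb x :=
    M.haltProb_ideal he hth hL fun q y t =>
      ⟨fun h => h.elim inl_mem_liftStates.1 (by simp), fun h => Or.inl (inl_mem_liftStates.2 h)⟩
  have h2 : ∀ x, M.rejProb x = (M.ideal hL _).rejProb x :=
    M.haltProb_ideal he hth hL fun q y t => inl_mem_liftStates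
  refine ⟨?_, fun x => ⟨h1 x, h2 x⟩⟩
  ext x
  simp [NoEndmarker.language, h1]

theorem NoEndmarker.idealShape_ideal (M : NoEndmarker A Q G) {L₁ : ℕ} (hL : 1 ≤ L₁) (L₂ : ℕ) :
    (M.ideal hL L₂).IdealShape := by
  intro x hx
  have : (M.ideal hL L₂).deltaOn x = OnePPDA.idealDelta M.theta M.deltaNonempty ∅ := by
    rw [Core.deltaOn_of_ne_nil _ hx]
    exact M.idealCore_deltaNonempty _ _
  rw [this]
  exact idealConditions_idealDelta

end NoEndmarkerModel

/-! ### Renaming states and stack symbols -/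

section Reindex

variable {Q G Q' G' : Type*} (eQ : Q ≃ Q') (eG : G ≃ G') {S : Type*}

/-- A transition function with renamed states and stack symbols. -/
def reindexDelta (d : Q → Option S → G → Q → List G → ℝ≥0) :
    Q' → Option S → G' → Q' → List G' → ℝ≥0 :=
  fun q s a p u => d (eQ.symm q) s (eG.symm a) (eQ.symm p) (u.map eG.symm)

/-- A set of strings with renamed stack symbols. -/
def reindexTheta (th : Finset (List G)) : Finset (List G') :=
  th.map ⟨List.map eG, List.map_injective_iff.2 eG.injective⟩

theorem mem_reindexTheta {th : Finset (List G)} {u : List G'} :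
    u ∈ reindexTheta eG th ↔ u.map eG.symm ∈ th := by
  simp only [reindexTheta, Finset.mem_map, Function.Embedding.coeFn_mk]
  constructor
  · rintro ⟨v, hv, rfl⟩
    simpa using hv
  · exact fun h => ⟨_, h, by simp⟩

/-- A configuration with the original names of its states and stack symbols. -/
def unindex (c : Config S Q' G') : Config S Q G := (eQ.symm c.1, c.2.1, c.2.2.map eG.symm)

variable {eQ eG}

theorem Follows.unindex {d : Q → Option S → G → Q → List G → ℝ≥0} {c c' : Config S Q' G'}
    (h : Follows (reindexDelta eQ eG d) c c') :
    Follows d (unindex eQ eG c) (unindex eQ eG c') := by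
  rcases h with ⟨q, a, p, u, rest, z, h⟩ | ⟨q, s, a, p, u, rest, z, h⟩
  · simpa [OnePPDA.unindex] using
      Follows.lam (eQ.symm q) (eG.symm a) (eQ.symm p) _ rest (z.map eG.symm) h
  · simpa [OnePPDA.unindex] using
      Follows.read (eQ.symm q) s (eG.symm a) (eQ.symm p) _ rest (z.map eG.symm) h

theorem NoInfinitePath.reindex {d : Q → Option S → G → Q → List G → ℝ≥0} {c : Config S Q' G'}
    (h : NoInfinitePath d (unindex eQ eG c)) : NoInfinitePath (reindexDelta eQ eG d) c := by
  rintro ⟨f, rfl, hf⟩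
  exact h ⟨fun k => unindex eQ eG (f k), rfl, fun k => (hf k).unindex⟩

variable (eQ eG)

/-- A machine with renamed states and stack symbols. -/
def Core.reindex (M : Core S Q G) : Core S Q' G' where
  theta := reindexTheta eG M.theta
  nil_mem_theta := (mem_reindexTheta eG).2 M.nil_mem_theta
  delta := reindexDelta eQ eG M.delta
  mem_theta _ _ _ _ _ h := (mem_reindexTheta eG).2 (M.mem_theta _ _ _ _ _ h)
  q0 := eQ M.q0
  Z0 := eG M.Z0
  acc := eQ.symm ⁻¹' M.acc
  rej := eQ.symm ⁻¹' M.rej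
  disjoint_acc_rej := M.disjoint_acc_rej.preimage _
  delta_of_ne_bottom q s a p u h ha hu := by
    refine M.delta_of_ne_bottom _ _ _ _ _ h (fun h' => ha ?_) ?_
    · rw [← h', Equiv.apply_symm_apply]
    · exact List.mem_map.2 ⟨_, hu, by simp⟩
  delta_of_bottom q s p u h := by
    simp only [reindexDelta, Equiv.symm_apply_apply] at h
    obtain ⟨v, hv, huv⟩ := M.delta_of_bottom _ _ _ _ h
    refine ⟨v.map eG, by simpa using hv, ?_⟩
    have := congrArg (List.map eG) huv
    simpa using this

theorem Core.deltaOn_reindex (M : Core S Q G) (x : List S) :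
    (M.reindex eQ eG).deltaOn x = reindexDelta eQ eG (M.deltaOn x) := by
  classical
  funext q s a p u
  simp only [Core.deltaOn, Core.reindex, reindexDelta, Equiv.symm_apply_eq]
  congr

variable [Fintype Q] [Fintype Q']

theorem sum_reindexTheta (th : Finset (List G)) (f : Q → List G → ℝ≥0) :
    ∑ p : Q', ∑ u ∈ reindexTheta eG th, f (eQ.symm p) (u.map eG.symm) =
      ∑ p, ∑ u ∈ th, f p u := by
  rw [← Equiv.sum_comp eQ.symm (fun p => ∑ u ∈ th, f p u)]
  refine Finset.sum_congr rfl fun p _ => ?_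
  simp [reindexTheta, Function.comp_def]

theorem total_reindex (th : Finset (List G)) (d : Q → Option S → G → Q → List G → ℝ≥0)
    (q : Q') (s : Option S) (a : G') :
    total (reindexTheta eG th) (reindexDelta eQ eG d) q s a =
      total th d (eQ.symm q) s (eG.symm a) :=
  sum_reindexTheta eQ eG th fun p u => d (eQ.symm q) s (eG.symm a) p u

/-- Renaming by `Fin n` and `Fin m` brings the constructed machine into `Type`, whatever the
universes of `Q` and `G`; this invariance makes it harmless for the probabilities. -/
theorem pathWeight_reindex (th : Finset (List G)) (d : Q → Option S → G → Q → List G → ℝ≥0)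
    (fin : Config S Q G → ℝ≥0) (t : ℕ) : ∀ (q : Q') (rest : List S) (z : List G'),
    pathWeight (reindexTheta eG th) (reindexDelta eQ eG d) (fun c => fin (unindex eQ eG c))
      t q rest z = pathWeight th d fin t (eQ.symm q) rest (z.map eG.symm) := by
  induction t with
  | zero => intro q rest z; simp [pathWeight, unindex]
  | succ t ih =>
    intro q rest z
    have key : ∀ (s : Option S) (rest : List S) (a : G') (z : List G'),
        ∑ p : Q', ∑ u ∈ reindexTheta eG th, reindexDelta eQ eG d q s a p u *
          pathWeight (reindexTheta eG th) (reindexDelta eQ eG d)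
            (fun c => fin (unindex eQ eG c)) t p rest (u ++ z) =
        ∑ p : Q, ∑ u ∈ th, d (eQ.symm q) s (eG.symm a) p u *
          pathWeight th d fin t p rest (u ++ z.map eG.symm) := by
      intro s rest a z
      simp only [ih, List.map_append]
      exact sum_reindexTheta eQ eG th fun p u => d (eQ.symm q) s (eG.symm a) p u *
          pathWeight th d fin t p rest (u ++ z.map eG.symm)
    cases z with
    | nil => simp [pathWeight]
    | cons a z =>
      cases rest with
      | nil => simp only [pathWeight, List.map_cons]; exact key _ _ _ _
      | cons s rest => simp only [pathWeight, List.map_cons]; rw [key, key]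

/-- A machine with endmarkers, with renamed states and stack symbols. -/
def Endmarker.reindex {A : Type*} (M : Endmarker A Q G) : Endmarker A Q' G' where
  toCore := M.toCore.reindex eQ eG
  delta_halt _ _ _ _ _ hq := M.delta_halt _ _ _ _ _ hq
  prob q hq s a := by
    have := M.prob (eQ.symm q) hq s (eG.symm a)
    rwa [← total_reindex eQ eG, ← total_reindex eQ eG] at this
  first_step := by
    refine (total_reindex eQ eG _ _ _ _ _).trans ?_
    simpa [Core.reindex] using M.first_step
  no_infinite_path x := by
    refine NoInfinitePath.reindex ?_
    simpa [unindex, Core.reindex] using M.no_infinite_path x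
  not_stuck x q a z hr hq := by
    have : Relation.ReflTransGen (Follows M.delta) (M.q0, endmarked x, [M.Z0])
        (eQ.symm q, [], eG.symm a :: z.map eG.symm) := by
      have := Relation.ReflTransGen.lift (p := Follows M.delta) (unindex eQ eG)
        (fun _ _ h => Follows.unindex h) _ _ hr
      simpa [unindex, Core.reindex, Function.onFun] using this
    exact (total_reindex eQ eG _ _ _ _ _).trans (M.not_stuck x _ _ _ this hq)

theorem Endmarker.haltProb_reindex {A : Type*} (M : Endmarker A Q G) (F : Set Q) (x : List A) :
    (M.reindex eQ eG).haltProb (eQ.symm ⁻¹' F) x = M.haltProb F x := by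
  classical
  refine tsum_congr fun t => ?_
  congr 1
  have := pathWeight_reindex eQ eG M.theta M.delta (fun c => if c.1 ∈ F then 1 else 0) t (eQ M.q0)
    (endmarked x) [eG M.Z0]
  simp only [Equiv.symm_apply_apply, List.map_cons, List.map_nil] at this
  exact this

/-- A machine without endmarkers, with renamed states and stack symbols. -/
def NoEndmarker.reindex {A : Type*} (M : NoEndmarker A Q G) : NoEndmarker A Q' G' where
  toCore := M.toCore.reindex eQ eG
  acc_union_rej := by
    change eQ.symm ⁻¹' (M.acc ∪ M.rej) = Set.univ
    rw [M.acc_union_rej, Set.preimage_univ]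
  prob q s a h := by
    have := M.prob (eQ.symm q) s (eG.symm a) (by
      rw [Equiv.symm_apply_eq, Equiv.symm_apply_eq]; exact h)
    rwa [← total_reindex eQ eG, ← total_reindex eQ eG] at this
  first_step s := by
    refine (total_reindex eQ eG _ _ _ _ _).trans ?_
    simpa [Core.reindex] using M.first_step s
  first_step_empty := by
    refine (total_reindex eQ eG _ _ _ _ _).trans_le ?_
    simpa [Core.reindex] using M.first_step_empty
  no_infinite_path x := by
    rw [Core.deltaOn_reindex]
    refine NoInfinitePath.reindex ?_
    simpa [unindex, Core.reindex] using M.no_infinite_path x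

theorem NoEndmarker.haltProb_reindex {A : Type*} (M : NoEndmarker A Q G) (F : Set Q)
    (x : List A) : (M.reindex eQ eG).haltProb (eQ.symm ⁻¹' F) x = M.haltProb F x := by
  classical
  have hd : (M.reindex eQ eG).deltaOn x = reindexDelta eQ eG (M.deltaOn x) :=
    M.toCore.deltaOn_reindex eQ eG x
  have hfin : (M.reindex eQ eG).stopProb (eQ.symm ⁻¹' F) x =
      fun c => M.stopProb F x (OnePPDA.unindex eQ eG c) := by
    funext c
    obtain ⟨q, rest, z⟩ := c
    cases rest with
    | cons s rest => cases z <;> simp [stopProb, OnePPDA.unindex]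
    | nil =>
      cases z with
      | nil => simp [stopProb, OnePPDA.unindex]
      | cons a z =>
        simp only [stopProb, OnePPDA.unindex, List.map_cons, Set.mem_preimage, hd]
        congr 2
        exact total_reindex eQ eG _ _ _ _ _
  refine tsum_congr fun t => ?_
  congr 1
  have := pathWeight_reindex eQ eG M.theta (M.deltaOn x) (M.stopProb F x) t (eQ M.q0) x [eG M.Z0]
  simp only [Equiv.symm_apply_apply, List.map_cons, List.map_nil] at this
  rw [hd, hfin]
  exact this

end Reindex

/-! ### Counting states and stack symbols -/

section Bounds

theorem Core.length_le_pushSize {S Q G : Type*} (M : Core S Q G) :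
    0 < M.pushSize ∧ ∀ u ∈ M.theta, u.length ≤ M.pushSize := by
  have hne : {e : ℕ | 0 < e ∧ ∀ u ∈ M.theta, u.length ≤ e}.Nonempty :=
    ⟨M.theta.sup List.length + 1, Nat.succ_pos _, fun u hu =>
      (Finset.le_sup (f := List.length) hu).trans (Nat.le_succ _)⟩
  exact Nat.sInf_mem hne

theorem Core.length_le_of_mem_reindex {S Q G Q' G' : Type*} (M : Core S Q G) (eQ : Q ≃ Q')
    (eG : G ≃ G') : ∀ u ∈ (M.reindex eQ eG).theta, u.length ≤ M.pushSize := by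
  intro u hu
  have := M.length_le_pushSize.2 _ ((mem_reindexTheta eG).1 hu)
  simpa using this

theorem card_block_le {m : ℕ} (hm : 0 < m) (L : ℕ) :
    Fintype.card (Block (Fin m) L) ≤ (2 * m) ^ L := by
  -- A block is given by `L` entries from `m + 1 ≤ 2m` values, the additional value marking
  -- positions past its end.
  refine (Block.card_le L).trans (Nat.pow_le_pow_left ?_ L)
  rw [Fintype.card_fin]
  omega

theorem runBound_add_blockBound_le {e n m : ℕ} (he : 0 < e) (hn : 0 < n) (hm : 0 < m) :
    runBound e (n * m) + blockBound e (n * m) ≤ 2 * e * n * m := by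
  obtain ⟨k, hk⟩ := Nat.exists_eq_add_of_lt (Nat.mul_pos hn hm)
  obtain ⟨e, rfl⟩ := Nat.exists_eq_add_of_lt he
  have : 2 * (0 + e + 1) * n * m = 2 * (e + 1) * (k + 1) := by
    rw [mul_assoc _ n m, hk]; ring
  rw [this, hk]
  simp only [runBound, blockBound, zero_add, Nat.add_sub_cancel]
  nlinarith

theorem card_iState_le {e n m : ℕ} (he : 0 < e) (hn : 0 < n) (hm : 0 < m) :
    Fintype.card (IState (Fin n) (Fin m) (runBound e (n * m)) (blockBound e (n * m))) ≤
      2 * (e * n ^ 2 * m ^ 2 * (2 * m) ^ (2 * e * n * m)) := by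
  have h1 : Fintype.card (Block (Fin m) (runBound e (n * m))) *
      Fintype.card (Block (Fin m) (blockBound e (n * m))) ≤ (2 * m) ^ (2 * e * n * m) :=
    (Nat.mul_le_mul (card_block_le hm _) (card_block_le hm _)).trans (by
      rw [← pow_add]
      exact Nat.pow_le_pow_right (by omega) (runBound_add_blockBound_le he hn hm))
  have h2 : n ≤ e * n ^ 2 * m ^ 2 := by
    have : 0 < e * n * m ^ 2 := by positivity
    calc n ≤ (e * n * m ^ 2) * n := Nat.le_mul_of_pos_left _ this
      _ = e * n ^ 2 * m ^ 2 := by ring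
  have h3 : 1 ≤ (2 * m) ^ (2 * e * n * m) := Nat.one_le_pow _ _ (by omega)
  rw [Fintype.card_sum, Fintype.card_prod, Fintype.card_prod, Fintype.card_fin]
  have h4 := Nat.mul_le_mul h2 h1
  have h5 := Nat.mul_le_mul h2 h3
  omega

theorem card_iSym_le {e n m : ℕ} (he : 0 < e) (hn : 0 < n) (hm : 0 < m) :
    Fintype.card (ISym (Fin m) (blockBound e (n * m))) ≤
      2 * (e * n * m * (2 * m) ^ (2 * e * n * m)) := by
  have h1 : Fintype.card (Block (Fin m) (blockBound e (n * m))) ≤ (2 * m) ^ (2 * e * n * m) :=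
    (card_block_le hm _).trans (Nat.pow_le_pow_right (by omega)
      ((Nat.le_add_left _ _).trans (runBound_add_blockBound_le he hn hm)))
  have h2 : 1 ≤ e * n * m := Nat.mul_pos (Nat.mul_pos he hn) hm
  have h3 : 1 ≤ (2 * m) ^ (2 * e * n * m) := Nat.one_le_pow _ _ (by omega)
  rw [Fintype.card_option]
  have h4 := Nat.mul_le_mul h2 h1
  have h5 := Nat.mul_le_mul h2 h3
  omega

end Bounds

/-! ### Assembly: renaming followed by the ideal-shape construction -/

theorem Endmarker.exists_idealShape {A Q G : Type*} [Fintype Q] [Fintype G]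
    (M : Endmarker A Q G) {n m : ℕ} (hn : Fintype.card Q = n) (hm : Fintype.card G = m) :
    ∃ N : Endmarker A
        (IState (Fin n) (Fin m) (runBound M.pushSize (n * m)) (blockBound M.pushSize (n * m)))
        (ISym (Fin m) (blockBound M.pushSize (n * m))),
      M.ErrorEquivalent N ∧ N.IdealShape := by
  have eQ : Q ≃ Fin n := Fintype.equivFinOfCardEq hn
  have eG : G ≃ Fin m := Fintype.equivFinOfCardEq hm
  have hth := M.length_le_of_mem_reindex eQ eG
  have key : ∃ N : Endmarker A
      (IState (Fin n) (Fin m)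
        (runBound M.pushSize (Fintype.card (Fin n) * Fintype.card (Fin m)))
        (blockBound M.pushSize (Fintype.card (Fin n) * Fintype.card (Fin m))))
      (ISym (Fin m) (blockBound M.pushSize (Fintype.card (Fin n) * Fintype.card (Fin m)))),
      M.ErrorEquivalent N ∧ N.IdealShape := by
    refine ⟨(M.reindex eQ eG).ideal M.length_le_pushSize.1 hth, ?_,
      Endmarker.idealShape_ideal _ _ _⟩
    have h := (M.reindex eQ eG).errorEquivalent_ideal M.length_le_pushSize.1 hth
    have ha : ∀ x, M.accProb x = (M.reindex eQ eG).accProb x :=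
      fun x => (M.haltProb_reindex eQ eG M.acc x).symm
    have hr : ∀ x, M.rejProb x = (M.reindex eQ eG).rejProb x :=
      fun x => (M.haltProb_reindex eQ eG M.rej x).symm
    refine ⟨?_, fun x => ⟨(ha x).trans (h.2 x).1, (hr x).trans (h.2 x).2⟩⟩
    rw [← h.1]
    ext x
    simp [Endmarker.language, ha]
  rwa [Fintype.card_fin n, Fintype.card_fin m] at key

theorem NoEndmarker.exists_idealShape {A Q G : Type*} [Nonempty A] [Fintype Q] [Fintype G]
    (M : NoEndmarker A Q G) {n m : ℕ} (hn : Fintype.card Q = n) (hm : Fintype.card G = m) :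
    ∃ N : NoEndmarker A
        (IState (Fin n) (Fin m) (runBound M.pushSize (n * m)) (blockBound M.pushSize (n * m)))
        (ISym (Fin m) (blockBound M.pushSize (n * m))),
      M.ErrorEquivalent N ∧ N.IdealShape := by
  have eQ : Q ≃ Fin n := Fintype.equivFinOfCardEq hn
  have eG : G ≃ Fin m := Fintype.equivFinOfCardEq hm
  have hth := M.length_le_of_mem_reindex eQ eG
  have key : ∃ N : NoEndmarker A
      (IState (Fin n) (Fin m)
        (runBound M.pushSize (Fintype.card (Fin n) * Fintype.card (Fin m)))
        (blockBound M.pushSize (Fintype.card (Fin n) * Fintype.card (Fin m))))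
      (ISym (Fin m) (blockBound M.pushSize (Fintype.card (Fin n) * Fintype.card (Fin m)))),
      M.ErrorEquivalent N ∧ N.IdealShape := by
    refine ⟨(M.reindex eQ eG).ideal (by simp [runBound]) _, ?_,
      NoEndmarker.idealShape_ideal _ _ _⟩
    have h := (M.reindex eQ eG).errorEquivalent_ideal M.length_le_pushSize.1 hth
      (by simp [runBound])
    have ha : ∀ x, M.accProb x = (M.reindex eQ eG).accProb x :=
      fun x => (M.haltProb_reindex eQ eG M.acc x).symm
    have hr : ∀ x, M.rejProb x = (M.reindex eQ eG).rejProb x :=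
      fun x => (M.haltProb_reindex eQ eG M.rej x).symm
    refine ⟨?_, fun x => ⟨(ha x).trans (h.2 x).1, (hr x).trans (h.2 x).2⟩⟩
    rw [← h.1]
    ext x
    simp [NoEndmarker.language, ha]
  rwa [Fintype.card_fin n, Fintype.card_fin m] at key

end OnePPDA

theorem mainTheorem5 :
    ∃ C : ℕ,
      (∀ (A Q G : Type*) [Fintype A] [Nonempty A] [Fintype Q] [Fintype G] (n m e : ℕ)
        (M : OnePPDA.Endmarker A Q G),
        Fintype.card Q = n → Fintype.card G = m → M.pushSize = e →
        ∃ (Q' G' : Type) (_ : Fintype Q') (_ : Fintype G') (N : OnePPDA.Endmarker A Q' G'),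
          M.ErrorEquivalent N ∧ N.IdealShape ∧
          Fintype.card Q' ≤ C * (e * n ^ 2 * m ^ 2 * (2 * m) ^ (2 * e * n * m)) ∧
          Fintype.card G' ≤ C * (e * n * m * (2 * m) ^ (2 * e * n * m))) ∧
      (∀ (A Q G : Type*) [Fintype A] [Nonempty A] [Fintype Q] [Fintype G] (n m e : ℕ)
        (M : OnePPDA.NoEndmarker A Q G),
        Fintype.card Q = n → Fintype.card G = m → M.pushSize = e →
        ∃ (Q' G' : Type) (_ : Fintype Q') (_ : Fintype G') (N : OnePPDA.NoEndmarker A Q' G'),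
          M.ErrorEquivalent N ∧ N.IdealShape ∧
          Fintype.card Q' ≤ C * (e * n ^ 2 * m ^ 2 * (2 * m) ^ (2 * e * n * m)) ∧
          Fintype.card G' ≤ C * (e * n * m * (2 * m) ^ (2 * e * n * m))) := by
  -- One unit of the constant pays for the states `inl` or the blocks, the other for the states
  -- `inr` or the bottom marker.
  refine ⟨2, ?_, ?_⟩
  · rintro A Q G _ _ _ _ n m e M hn hm rfl
    have hn0 : 0 < n := hn ▸ Fintype.card_pos_iff.2 ⟨M.q0⟩
    have hm0 : 0 < m := hm ▸ Fintype.card_pos_iff.2 ⟨M.Z0⟩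
    obtain ⟨N, h1, h2⟩ := M.exists_idealShape hn hm
    exact ⟨_, _, _, _, N, h1, h2, OnePPDA.card_iState_le M.length_le_pushSize.1 hn0 hm0,
      OnePPDA.card_iSym_le M.length_le_pushSize.1 hn0 hm0⟩
  · rintro A Q G _ _ _ _ n m e M hn hm rfl
    have hn0 : 0 < n := hn ▸ Fintype.card_pos_iff.2 ⟨M.q0⟩
    have hm0 : 0 < m := hm ▸ Fintype.card_pos_iff.2 ⟨M.Z0⟩
    obtain ⟨N, h1, h2⟩ := M.exists_idealShape hn hm
    exact ⟨_, _, _, _, N, h1, h2, OnePPDA.card_iState_le M.length_le_pushSize.1 hn0 hm0,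
      OnePPDA.card_iSym_le M.length_le_pushSize.1 hn0 hm0⟩
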